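/- Let $N\ge 2$, let $x_0<x_1<\dots<x_N$ and $y_0,\dots,y_N$ be real numbers, and put $I=[x_0,x_N]$. For $1\le i\le N$ let $L_i$ be the affine map with $L_i(x_0)=x_{i-1}$, $L_i(x_N)=x_i$, let $S_i,q_i$ be continuous real functions on $I$ with $|S_i|<1$ on $I$, $S_i(x_0)y_0+q_i(x_0)=y_{i-1}$ and $S_i(x_N)y_N+q_i(x_N)=y_i$, and put $W_i(x,y)=(L_i(x),\,S_i(x)y+q_i(x))$. Let $f$ be the corresponding generalized affine fractal interpolation function, i.e. the continuous function on $I$ whose graph $\Gamma f=\{(x,f(x)):x\in I\}$ satisfies $\Gamma f=\bigcup_{i=1}^N W_i(\Gamma f)$. Assume for every $i$: (A1) $x_i-x_{i-1}=(x_N-x_0)/N$; (A2) $S_i$ is Lipschitz on $I$ and $|S_i|<1$ on $I$; (A3) $q_i$ is of bounded variation on $I$. Put $\gamma_*=\min_{x\in I}\sum_{i=1}^N|S_i(x)|$. For $k\ge1$ let $I^k_1,\dots,I^k_{N^k}$ be the division of $I$, from left to right, into $N^k$ closed intervals of equal length, and let $\overline s^{\,k}_{i,j}=\max_{I^k_j}|S_i|$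 and $\underline s^{\,k}_{i,j}=\min_{I^k_j}|S_i|$. Let $\overline M_k$ be the $N^k\times N^k$ matrix such that, for $1\le i\le N$, $1\le\ell\le N^{k-1}$ and $1\le j\le N^k$, the entry in row $(i-1)N^{k-1}+\ell$ and column $j$ is $\overline s^{\,k}_{i,j}$ if $(\ell-1)N<j\le\ell N$, and $0$ otherwise; let $\underline M_k$ be the same matrix with $\underline s^{\,k}_{i,j}$ in place of $\overline s^{\,k}_{i,j}$. Let $\rho(A)$ denote the spectral radius of a matrix $A$, $\mathrm{Var}(f,I)\in[0,\infty]$ the total variation of $f$ on $I$, and $\overline{\dim}_B,\underline{\dim}_B,\dim_B$ the upper, the lower and the box dimension. Then the limits $\rho^*=\lim_{k\to\infty}\rho(\overline M_k)$ and $\rho_*=\lim_{k\to\infty}\rho(\underline M_k)$ exist in $[0,\infty)$, and the following hold. (1) If no $S_i$ vanishes identically on any nondegenerate subinterval of $I$, then $\overline{\dim}_B\Gamma f\le\max\{1,\,1+\log\rho^*/\log N\}$ (the right-hand side being $1$ if $\rho^*=0$). (2) If $\gamma_*\ge1$, each $S_i$ has only finitely many zeros on $I$, and $\mathrm{Var}(f,I)=\infty$,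 then $\underline{\dim}_B\Gamma f\ge1+\log\rho_*/\log N$. (3) Suppose that $\rho^*=\rho_*=:\rho_{\mathbf S}$ and each $S_i$ has only finitely many zeros on $I$. If $\mathrm{Var}(f,I)=\infty$ and $\rho_{\mathbf S}>1$, then $\dim_B\Gamma f$ exists and equals $1+\log\rho_{\mathbf S}/\log N$; otherwise $\dim_B\Gamma f$ exists and equals $1$. -/

import Mathlib

open Filter Topology

/-! ### Box dimension of plane sets -/

/-- The `ε`-coordinate square `[k₁ε, (k₁+1)ε] × [k₂ε, (k₂+1)ε]`. -/
def coordSquare (ε : ℝ) (k : ℤ × ℤ) : Set (ℝ × ℝ) :=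
  Set.Icc (k.1 * ε) ((k.1 + 1) * ε) ×ˢ Set.Icc (k.2 * ε) ((k.2 + 1) * ε)

/-- The number of `ε`-coordinate squares that meet the bounded set `E`. -/
noncomputable def boxCount (E : Set (ℝ × ℝ)) (ε : ℝ) : ℕ :=
  {k : ℤ × ℤ | (coordSquare ε k ∩ E).Nonempty}.ncard

/-- Upper box dimension of a bounded set, with the upper limit taken in the extended reals. -/
noncomputable def upperBoxDim (E : Set (ℝ × ℝ)) : EReal :=
  limsup (fun ε : ℝ => ((Real.log (boxCount E ε) / Real.log (1 / ε) : ℝ) : EReal)) (𝓝[>] 0)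

/-- Lower box dimension of a bounded set, with the lower limit taken in the extended reals. -/
noncomputable def lowerBoxDim (E : Set (ℝ × ℝ)) : EReal :=
  liminf (fun ε : ℝ => ((Real.log (boxCount E ε) / Real.log (1 / ε) : ℝ) : EReal)) (𝓝[>] 0)

/-- The box dimension of `E` exists and equals `d`. -/
def HasBoxDim (E : Set (ℝ × ℝ)) (d : ℝ) : Prop :=
  lowerBoxDim E = (d : EReal) ∧ upperBoxDim E = (d : EReal)

/-! ### Spectral radius of a real square matrix -/

/-- The largest modulus of a complex eigenvalue of the real square matrix `A`. -/
noncomputable def matrixSpectralRadius {n : ℕ} (A : Matrix (Fin n) (Fin n) ℝ) : ℝ :=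
  (spectralRadius ℂ (A.map Complex.ofReal)).toReal

/-! ### Generalized affine fractal interpolation functions -/

/-- The data of a generalized affine iterated function system
`W_i(x, y) = (a_i x + b_i, S_i(x) y + q_i(x))`, `1 ≤ i ≤ N`, interpolating the points
`(x_0, y_0), …, (x_N, y_N)`.  The index `i : Fin N` stands for the number `i + 1`, so that
`x i.castSucc` and `x i.succ` are the end points of the `i`-th interval of the partition.
Only the values of `S i` and `q i` on `[x_0, x_N]` matter. -/
structure AffineIFS (N : ℕ) where
  x : Fin (N + 1) → ℝ
  y : Fin (N + 1) → ℝ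
  S : Fin N → ℝ → ℝ
  q : Fin N → ℝ → ℝ
  two_le : 2 ≤ N
  strictMono_x : StrictMono x
  continuousOn_S : ∀ i, ContinuousOn (S i) (Set.Icc (x 0) (x (Fin.last N)))
  continuousOn_q : ∀ i, ContinuousOn (q i) (Set.Icc (x 0) (x (Fin.last N)))
  abs_S_lt_one : ∀ i, ∀ t ∈ Set.Icc (x 0) (x (Fin.last N)), |S i t| < 1
  left_end : ∀ i, S i (x 0) * y 0 + q i (x 0) = y i.castSucc
  right_end : ∀ i, S i (x (Fin.last N)) * y (Fin.last N) + q i (x (Fin.last N)) = y i.succ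

namespace AffineIFS

variable {N : ℕ} (W : AffineIFS N)

/-- The interval `I = [x_0, x_N]`. -/
def I : Set ℝ := Set.Icc (W.x 0) (W.x (Fin.last N))

/-- The affine map with `x_0 ↦ x_{i-1}` and `x_N ↦ x_i`. -/
noncomputable def L (i : Fin N) (t : ℝ) : ℝ :=
  (W.x i.succ - W.x i.castSucc) / (W.x (Fin.last N) - W.x 0) * (t - W.x 0) + W.x i.castSucc

/-- The map `W_i(x, y) = (L_i(x), S_i(x) y + q_i(x))`. -/
noncomputable def map (i : Fin N) (p : ℝ × ℝ) : ℝ × ℝ :=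
  (W.L i p.1, W.S i p.1 * p.2 + W.q i p.1)

/-- The graph of `f` over `I`. -/
def graph (f : ℝ → ℝ) : Set (ℝ × ℝ) := (fun t => (t, f t)) '' W.I

/-- `f` (restricted to `I`) is the fractal interpolation function of the system: it is
continuous on `I` and its graph is invariant, `Γf = ⋃ i, W_i(Γf)`. -/
def IsFIF (f : ℝ → ℝ) : Prop :=
  ContinuousOn f W.I ∧ W.graph f = ⋃ i, W.map i '' W.graph f

/-- Condition (A1): the nodes are equally spaced. -/
def A1 : Prop :=
  ∀ i : Fin N, W.x i.succ - W.x i.castSucc = (W.x (Fin.last N) - W.x 0) / N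

/-- Condition (A2): each `S_i` is Lipschitz on `I`, with `|S_i| < 1` there. -/
def A2 : Prop :=
  ∀ i : Fin N, (∃ K, LipschitzOnWith K (W.S i) W.I) ∧ ∀ t ∈ W.I, |W.S i t| < 1

/-- Condition (A3): each `q_i` is of bounded variation on `I`. -/
def A3 : Prop := ∀ i : Fin N, BoundedVariationOn (W.q i) W.I

/-- The sum function `γ = ∑ |S_i|`. -/
noncomputable def gamma (t : ℝ) : ℝ := ∑ i, |W.S i t|

/-- The minimum `γ_*` of `γ` on `I`. -/
noncomputable def gammaLow : ℝ := sInf (W.gamma '' W.I)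

/-- The `j`-th interval of the subdivision of `I` into `N ^ k` equal closed intervals
(`j` is counted from `0`). -/
def subI (k : ℕ) (j : Fin (N ^ k)) : Set ℝ :=
  Set.Icc (W.x 0 + (j : ℝ) / (N : ℝ) ^ k * (W.x (Fin.last N) - W.x 0))
    (W.x 0 + ((j : ℝ) + 1) / (N : ℝ) ^ k * (W.x (Fin.last N) - W.x 0))

/-- The maximum of `|S_i|` on the `j`-th interval of level `k`. -/
noncomputable def sUp (k : ℕ) (i : Fin N) (j : Fin (N ^ k)) : ℝ :=
  sSup ((fun t => |W.S i t|) '' W.subI k j)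

/-- The minimum of `|S_i|` on the `j`-th interval of level `k`. -/
noncomputable def sLow (k : ℕ) (i : Fin N) (j : Fin (N ^ k)) : ℝ :=
  sInf ((fun t => |W.S i t|) '' W.subI k j)

end AffineIFS

/-- The `N ^ (k+1) × N ^ (k+1)` matrix built from numbers `s i j`: with all indices counted from
`0`, row `i * N ^ k + ℓ` (`i < N`, `ℓ < N ^ k`) has the entry `s i j` in the columns
`ℓ * N ≤ j < (ℓ + 1) * N`, and `0` elsewhere. -/
def scalingMatrix (N k : ℕ) (s : Fin N → Fin (N ^ (k + 1)) → ℝ) :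
    Matrix (Fin (N ^ (k + 1))) (Fin (N ^ (k + 1))) ℝ :=
  Matrix.of fun r j =>
    if r.val % N ^ k * N ≤ j.val ∧ j.val < (r.val % N ^ k + 1) * N then
      s ⟨r.val / N ^ k, Nat.div_lt_of_lt_mul (lt_of_lt_of_eq r.isLt (pow_succ N k))⟩ j
    else 0

namespace AffineIFS

variable {N : ℕ} (W : AffineIFS N)

/-- The upper vertical scaling matrix of level `k + 1`. -/
noncomputable def MUp (k : ℕ) : Matrix (Fin (N ^ (k + 1))) (Fin (N ^ (k + 1))) ℝ :=
  scalingMatrix N k (W.sUp (k + 1))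

/-- The lower vertical scaling matrix of level `k + 1`. -/
noncomputable def MLow (k : ℕ) : Matrix (Fin (N ^ (k + 1))) (Fin (N ^ (k + 1))) ℝ :=
  scalingMatrix N k (W.sLow (k + 1))

end AffineIFS

/-!
Rescaled to `[0, 1]`, the interpolation function is self-affine: on the `i`-th of `N` equal cells it
is an affinely rescaled copy of itself, multiplied by `S i` and perturbed by a function of bounded
variation. Box counts of the graph at scale `N ^ (-m)` are comparable to `N ^ m` times one plus the
sum of the oscillations over the `N ^ m` cells of level `m`, so the box dimensions are governed by
the exponential growth rate of these oscillation sums.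

Distribute the oscillation sum over the cells of a fixed level `k`. Going one level deeper acts on
the resulting vector, up to a bounded additive error, by a nonnegative matrix between the lower and
the upper scaling matrix. A Collatz–Wielandt test vector turns the spectral radius of the upper
matrix into an upper bound `C * θ ^ m`. A lower bound requires the oscillation vector to outgrow the
additive error first; this holds when the variation is infinite, because dividing by `S i` away from
its zeros spreads infinite variation to every cell. Summing test vectors over children compares
consecutive levels: the upper radii decrease in `k` and the lower radii increase.
-/

/-! ### Collatz–Wielandt bounds for the spectral radius of a nonnegative matrix -/

section NonnegativeMatrix

open Matrix

variable {m n : Type*} [Fintype n]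

lemma mulVec_nonneg {A : Matrix m n ℝ} (hA : ∀ i j, 0 ≤ A i j) {v : n → ℝ} (hv : 0 ≤ v) :
    0 ≤ A *ᵥ v :=
  fun i => Finset.sum_nonneg fun j _ => mul_nonneg (hA i j) (hv j)

lemma mulVec_le_mulVec {A : Matrix m n ℝ} (hA : ∀ i j, 0 ≤ A i j) {v w : n → ℝ} (hvw : v ≤ w) :
    A *ᵥ v ≤ A *ᵥ w :=
  fun i => Finset.sum_le_sum fun j _ => mul_le_mul_of_nonneg_left (hvw j) (hA i j)

lemma mulVec_le_mulVec_of_le {A B : Matrix m n ℝ} (hAB : ∀ i j, A i j ≤ B i j) {v : n → ℝ}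
    (hv : 0 ≤ v) : A *ᵥ v ≤ B *ᵥ v :=
  fun i => Finset.sum_le_sum fun j _ => mul_le_mul_of_nonneg_right (hAB i j) (hv j)

lemma exists_nonneg_le_smul {ι : Type*} [Finite ι] {v : ι → ℝ} (hv : ∀ i, 0 < v i) (f : ι → ℝ) :
    ∃ K : ℝ, 0 ≤ K ∧ f ≤ K • v := by
  obtain ⟨K, hK⟩ := Finite.exists_le fun i => f i / v i
  refine ⟨max K 0, le_max_right _ _, fun i => ?_⟩
  rw [Pi.smul_apply, smul_eq_mul, ← div_le_iff₀ (hv i)]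
  exact (hK i).trans (le_max_left _ _)

lemma le_of_smul_le_mulVec_of_mulVec_le_smul {A : Matrix n n ℝ} (hA : ∀ i j, 0 ≤ A i j)
    {u v : n → ℝ} {η θ : ℝ} (hu : 0 ≤ u) (hu0 : u ≠ 0) (hAu : η • u ≤ A *ᵥ u)
    (hv : ∀ i, 0 < v i) (hAv : A *ᵥ v ≤ θ • v) : η ≤ θ := by
  obtain ⟨j, hj⟩ := Function.ne_iff.1 hu0
  have : Nonempty n := ⟨j⟩
  obtain ⟨i, hi⟩ := Finite.exists_max fun i => u i / v i
  set c := u i / v i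
  have hui : u i = c * v i := (div_mul_cancel₀ _ (hv i).ne').symm
  have huv : u ≤ c • v := fun k => (div_le_iff₀ (hv k)).1 (hi k)
  have hc : 0 < c := (div_pos ((hu j).lt_of_ne' hj) (hv j)).trans_le (hi j)
  have hle : η * u i ≤ θ * u i :=
    calc η * u i ≤ (A *ᵥ u) i := hAu i
      _ ≤ (A *ᵥ (c • v)) i := mulVec_le_mulVec hA huv i
      _ = c * (A *ᵥ v) i := by rw [mulVec_smul, Pi.smul_apply, smul_eq_mul]
      _ ≤ c * (θ * v i) := mul_le_mul_of_nonneg_left (hAv i) hc.le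
      _ = θ * u i := by rw [hui]; ring
  exact le_of_mul_le_mul_right hle (hui ▸ mul_pos hc (hv i))

lemma exists_pos_mulVec_le_smul_of_pow [DecidableEq n] {A : Matrix n n ℝ}
    (hA : ∀ i j, 0 ≤ A i j) {θ : ℝ} (hθ : 0 < θ) {p : ℕ} (hp : p ≠ 0)
    (h : A ^ p *ᵥ 1 ≤ θ ^ p • 1) : ∃ v : n → ℝ, (∀ i, 0 < v i) ∧ A *ᵥ v ≤ θ • v := by
  let w : ℕ → n → ℝ := fun k => (θ ^ k)⁻¹ • A ^ k *ᵥ 1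
  have hw0 : w 0 = 1 := by simp [w]
  have hAw : ∀ k, A *ᵥ w k = θ • w (k + 1) := fun k => by
    simp only [w, mulVec_smul, mulVec_mulVec, smul_smul, ← pow_succ']
    congr 1
    rw [pow_succ]
    field_simp
  have hw : ∀ k, 0 ≤ w k := fun k => by
    induction k with
    | zero => rw [hw0]; exact zero_le_one
    | succ k ih =>
      rw [← inv_smul_smul₀ hθ.ne' (w (k + 1)), ← hAw]
      exact smul_nonneg (by positivity) (mulVec_nonneg hA ih)
  have hwp : w p ≤ w 0 := by
    calc w p ≤ (θ ^ p)⁻¹ • θ ^ p • 1 := smul_le_smul_of_nonneg_left h (by positivity)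
      _ = w 0 := by rw [inv_smul_smul₀ (by positivity), hw0]
  refine ⟨∑ k ∈ Finset.range p, w k, fun i => ?_, ?_⟩
  · rw [Finset.sum_apply]
    refine Finset.sum_pos' (fun k _ => hw k i) ⟨0, Finset.mem_range.2 (Nat.pos_of_ne_zero hp), ?_⟩
    simp [hw0]
  · calc A *ᵥ ∑ k ∈ Finset.range p, w k = θ • ∑ k ∈ Finset.range p, w (k + 1) := by
          simp only [mulVec_sum, hAw, Finset.smul_sum]
      _ = θ • (∑ k ∈ Finset.range p, w k + w p - w 0) := by
          rw [← Finset.sum_range_succ, Finset.sum_range_succ', add_sub_cancel_right]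
      _ ≤ θ • ∑ k ∈ Finset.range p, w k :=
          smul_le_smul_of_nonneg_left (by simpa [add_sub_assoc] using hwp) hθ.le

end NonnegativeMatrix

section SpectralRadius

open Matrix

attribute [local instance] Matrix.linftyOpNormedRing Matrix.linftyOpNormedAlgebra

variable {n : ℕ} {A : Matrix (Fin n) (Fin n) ℝ} {θ : ℝ}

lemma matrixSpectralRadius_nonneg (A : Matrix (Fin n) (Fin n) ℝ) : 0 ≤ matrixSpectralRadius A :=
  ENNReal.toReal_nonneg

lemma spectralRadius_ne_top (B : Matrix (Fin n) (Fin n) ℂ) : spectralRadius ℂ B ≠ ⊤ :=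
  ne_top_of_le_ne_top (by finiteness) (spectrum.spectralRadius_le_pow_nnnorm_pow_one_div ℂ B 0)

lemma exists_norm_pow_le_of_spectralRadius_lt {B : Matrix (Fin n) (Fin n) ℂ}
    (h : (spectralRadius ℂ B).toReal < θ) : ∃ p ≠ 0, ‖B ^ p‖ ≤ θ ^ p := by
  have hlim := (ENNReal.tendsto_toReal (spectralRadius_ne_top B)).comp
    (spectrum.pow_norm_pow_one_div_tendsto_nhds_spectralRadius B)
  obtain ⟨p, hp, hp0⟩ := ((hlim.eventually (gt_mem_nhds h)).and (eventually_ne_atTop 0)).exists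
  rw [Function.comp_apply, ENNReal.toReal_ofReal (by positivity)] at hp
  refine ⟨p, hp0, ?_⟩
  rw [one_div] at hp
  calc ‖B ^ p‖ = (‖B ^ p‖ ^ (p : ℝ)⁻¹) ^ p := (Real.rpow_inv_natCast_pow (norm_nonneg _) hp0).symm
    _ ≤ θ ^ p := pow_le_pow_left₀ (by positivity) hp.le p

lemma exists_pos_mulVec_le_smul_of_matrixSpectralRadius_lt (hA : ∀ i j, 0 ≤ A i j)
    (h : matrixSpectralRadius A < θ) : ∃ v : Fin n → ℝ, (∀ i, 0 < v i) ∧ A *ᵥ v ≤ θ • v := by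
  obtain ⟨p, hp, hAp⟩ := exists_norm_pow_le_of_spectralRadius_lt h
  refine exists_pos_mulVec_le_smul_of_pow hA ((matrixSpectralRadius_nonneg A).trans_lt h) hp
    fun i => ?_
  have hcast : ((A ^ p *ᵥ 1) i : ℂ) = ((A.map Complex.ofReal) ^ p *ᵥ 1) i := by
    have hpow : (A.map Complex.ofReal) ^ p = (A ^ p).map Complex.ofReal :=
      (Matrix.map_pow A Complex.ofRealHom p).symm
    simp [hpow, mulVec, dotProduct]
  calc (A ^ p *ᵥ 1) i ≤ ‖((A ^ p *ᵥ 1) i : ℂ)‖ := by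
        rw [Complex.norm_real]; exact le_abs_self _
    _ ≤ ‖(A.map Complex.ofReal) ^ p *ᵥ (1 : Fin n → ℂ)‖ := by
        rw [hcast]; exact norm_le_pi_norm _ i
    _ ≤ ‖(A.map Complex.ofReal) ^ p‖ * ‖(1 : Fin n → ℂ)‖ := linfty_opNorm_mulVec _ _
    _ ≤ θ ^ p * 1 := by
        gcongr
        · exact (norm_nonneg _).trans hAp
        · exact (pi_norm_le_iff_of_nonneg zero_le_one).2 fun _ => by simp
    _ = (θ ^ p • (1 : Fin n → ℝ)) i := rfl

lemma exists_matrixSpectralRadius_smul_le_mulVec [NeZero n] (hA : ∀ i j, 0 ≤ A i j) :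
    ∃ u : Fin n → ℝ, 0 ≤ u ∧ u ≠ 0 ∧ matrixSpectralRadius A • u ≤ A *ᵥ u := by
  obtain ⟨z, hz, hzρ⟩ := spectrum.exists_nnnorm_eq_spectralRadius (A.map Complex.ofReal)
  have hρ : matrixSpectralRadius A = ‖z‖ := by
    rw [matrixSpectralRadius, ← hzρ, ENNReal.coe_toReal, coe_nnnorm]
  rw [← spectrum_toLin', ← Module.End.hasEigenvalue_iff_mem_spectrum] at hz
  obtain ⟨w, hw⟩ := hz.exists_hasEigenvector
  have hwz : A.map Complex.ofReal *ᵥ w = z • w := by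
    rw [← toLin'_apply, hw.apply_eq_smul]
  refine ⟨fun i => ‖w i‖, fun i => norm_nonneg _, fun h => hw.2 ?_, fun i => ?_⟩
  · exact funext fun i => norm_eq_zero.1 (congrFun h i)
  · calc matrixSpectralRadius A * ‖w i‖ = ‖(A.map Complex.ofReal *ᵥ w) i‖ := by
          rw [hρ, hwz, Pi.smul_apply, smul_eq_mul, norm_mul]
      _ ≤ ∑ j, ‖A.map Complex.ofReal i j * w j‖ :=
          norm_sum_le Finset.univ fun j => A.map Complex.ofReal i j * w j
      _ = (A *ᵥ fun i => ‖w i‖) i := Finset.sum_congr rfl fun j _ => by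
          rw [norm_mul, map_apply, Complex.norm_real, Real.norm_of_nonneg (hA i j)]

lemma matrixSpectralRadius_le_of_mulVec_le_smul [NeZero n] (hA : ∀ i j, 0 ≤ A i j)
    {v : Fin n → ℝ} (hv : ∀ i, 0 < v i) (hAv : A *ᵥ v ≤ θ • v) : matrixSpectralRadius A ≤ θ :=
  let ⟨_, hu, hu0, hAu⟩ := exists_matrixSpectralRadius_smul_le_mulVec hA
  le_of_smul_le_mulVec_of_mulVec_le_smul hA hu hu0 hAu hv hAv

lemma le_matrixSpectralRadius_of_smul_le_mulVec (hA : ∀ i j, 0 ≤ A i j)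
    {u : Fin n → ℝ} (hu : 0 ≤ u) (hu0 : u ≠ 0) (hAu : θ • u ≤ A *ᵥ u) :
    θ ≤ matrixSpectralRadius A :=
  le_of_forall_gt_imp_ge_of_dense fun _ hη =>
    let ⟨_, hv, hAv⟩ := exists_pos_mulVec_le_smul_of_matrixSpectralRadius_lt hA hη
    le_of_smul_le_mulVec_of_mulVec_le_smul hA hu hu0 hAu hv hAv

lemma matrixSpectralRadius_mono [NeZero n] {B : Matrix (Fin n) (Fin n) ℝ}
    (hA : ∀ i j, 0 ≤ A i j) (hAB : ∀ i j, A i j ≤ B i j) :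
    matrixSpectralRadius A ≤ matrixSpectralRadius B := by
  obtain ⟨u, hu, hu0, hAu⟩ := exists_matrixSpectralRadius_smul_le_mulVec hA
  refine le_matrixSpectralRadius_of_smul_le_mulVec (fun i j => (hA i j).trans (hAB i j)) hu hu0
    (hAu.trans (mulVec_le_mulVec_of_le hAB hu))

lemma exists_le_mul_pow_of_le_mulVec_add (hA : ∀ i j, 0 ≤ A i j) {V : ℕ → Fin n → ℝ} {c : ℝ}
    (hV : ∀ p i, V (p + 1) i ≤ (A *ᵥ V p) i + c) (hθ1 : 1 ≤ θ)
    (hθ : matrixSpectralRadius A < θ) : ∃ C, 0 ≤ C ∧ ∀ p i, V p i ≤ C * θ ^ p := by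
  obtain ⟨η, hη, hηθ⟩ := exists_between hθ
  obtain ⟨v, hv, hAv⟩ := exists_pos_mulVec_le_smul_of_matrixSpectralRadius_lt hA hη
  obtain ⟨K, hK, hVK⟩ := exists_nonneg_le_smul hv fun i => max (V 0 i) (c / (θ - η))
  obtain ⟨B, hB, hvB⟩ := exists_nonneg_le_smul (fun _ => one_pos) v
  have hcK : ∀ i, c ≤ K * v i * (θ - η) := fun i =>
    (div_le_iff₀ (sub_pos.2 hηθ)).1 ((le_max_right _ _).trans (hVK i))
  have hbound : ∀ p, V p ≤ (K * θ ^ p) • v := fun p => by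
    induction p with
    | zero => exact fun i => by simpa using (le_max_left _ _).trans (hVK i)
    | succ p ih =>
      intro i
      have hstep : (A *ᵥ V p) i ≤ K * θ ^ p * (η * v i) :=
        calc (A *ᵥ V p) i ≤ (A *ᵥ ((K * θ ^ p) • v)) i := mulVec_le_mulVec hA ih i
          _ = K * θ ^ p * (A *ᵥ v) i := by rw [mulVec_smul, Pi.smul_apply, smul_eq_mul]
          _ ≤ K * θ ^ p * (η * v i) := mul_le_mul_of_nonneg_left (hAv i) (by positivity)
      have hc : c ≤ K * v i * (θ - η) * θ ^ p :=
        (hcK i).trans <| le_mul_of_one_le_right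
          (mul_nonneg (mul_nonneg hK (hv i).le) (sub_pos.2 hηθ).le) (one_le_pow₀ hθ1)
      calc V (p + 1) i ≤ (A *ᵥ V p) i + c := hV p i
        _ ≤ K * θ ^ p * (η * v i) + K * v i * (θ - η) * θ ^ p := add_le_add hstep hc
        _ = K * θ ^ (p + 1) * v i := by ring
  refine ⟨K * B, mul_nonneg hK hB, fun p i => (hbound p i).trans ?_⟩
  calc K * θ ^ p * v i ≤ K * θ ^ p * (B * 1) := mul_le_mul_of_nonneg_left (hvB i) (by positivity)
    _ = K * B * θ ^ p := by ring

lemma exists_mul_pow_le_of_mulVec_sub_le [NeZero n] (hA : ∀ i j, 0 ≤ A i j) {V : ℕ → Fin n → ℝ}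
    {c : ℝ} (hV0 : ∀ p, 0 ≤ V p) (hV : ∀ p i, (A *ᵥ V p) i - c ≤ V (p + 1) i)
    (hlarge : ∀ T, ∃ p, ∀ i, T ≤ V p i) (hθ1 : 1 ≤ θ) (hθ : θ < matrixSpectralRadius A) :
    ∃ C, 0 < C ∧ ∃ p₀ i, ∀ p, C * θ ^ p ≤ V (p₀ + p) i := by
  obtain ⟨u, hu, hu0, hAu⟩ := exists_matrixSpectralRadius_smul_le_mulVec hA
  set ρ := matrixSpectralRadius A
  obtain ⟨K, hK⟩ := Finite.exists_le fun i => c / ((ρ - θ) * u i)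
  obtain ⟨B, hB⟩ := Finite.exists_le u
  set t := max K 1
  have ht : 0 < t := one_pos.trans_le (le_max_right _ _)
  obtain ⟨p₀, hp₀⟩ := hlarge (t * B)
  have hbound : ∀ p i, t * θ ^ p * u i ≤ V (p₀ + p) i := fun p => by
    induction p with
    | zero =>
      intro i
      rw [pow_zero, mul_one]
      exact (mul_le_mul_of_nonneg_left (hB i) ht.le).trans (hp₀ i)
    | succ p ih =>
      intro i
      rcases (hu i).eq_or_lt' with hui | hui
      · rw [hui, Pi.zero_apply, mul_zero]
        exact hV0 _ i
      have hc : c ≤ t * ((ρ - θ) * u i) * θ ^ p := by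
        have hpos : 0 < (ρ - θ) * u i := mul_pos (sub_pos.2 hθ) hui
        refine ((div_le_iff₀ hpos).1 ((hK i).trans (le_max_left K 1))).trans ?_
        exact le_mul_of_one_le_right (mul_pos ht hpos).le (one_le_pow₀ hθ1)
      calc t * θ ^ (p + 1) * u i
          = t * θ ^ p * (ρ * u i) - t * ((ρ - θ) * u i) * θ ^ p := by ring
        _ ≤ t * θ ^ p * (A *ᵥ u) i - c :=
            sub_le_sub (mul_le_mul_of_nonneg_left (hAu i) (by positivity)) hc
        _ = (A *ᵥ ((t * θ ^ p) • u)) i - c := by rw [mulVec_smul, Pi.smul_apply, smul_eq_mul]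
        _ ≤ (A *ᵥ V (p₀ + p)) i - c := sub_le_sub_right (mulVec_le_mulVec hA ih i) c
        _ ≤ V (p₀ + (p + 1)) i := hV _ i
  obtain ⟨i, hi⟩ := Function.ne_iff.1 hu0
  refine ⟨t * u i, mul_pos ht ((hu i).lt_of_ne' hi), p₀, i, fun p => (hbound p i).trans_eq' ?_⟩
  ring

end SpectralRadius

/-! ### Scaling matrices -/

section ScalingMatrix

open Matrix

variable {N k : ℕ}

/-- Indices in `Fin (N ^ k)` are read as base-`N` words of length `k`, most significant digit
first; `appendDigit (ℓ, d)` is the word `ℓ` followed by the digit `d`, the `d`-th of the `N` cells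
into which the cell `ℓ` splits at the next level. -/
def appendDigit : Fin (N ^ k) × Fin N ≃ Fin (N ^ (k + 1)) :=
  finProdFinEquiv.trans (finCongr (pow_succ N k).symm)

/-- The word consisting of the digit `i` followed by `ℓ`: the image of the cell `ℓ` under the
`i`-th map of the iterated function system. -/
def prependDigit : Fin N × Fin (N ^ k) ≃ Fin (N ^ (k + 1)) :=
  finProdFinEquiv.trans (finCongr (pow_succ' N k).symm)

lemma appendDigit_val (ℓ : Fin (N ^ k)) (d : Fin N) :
    (appendDigit (ℓ, d) : ℕ) = ℓ * N + d := by
  simp [appendDigit, finProdFinEquiv, add_comm, mul_comm]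

lemma prependDigit_val (i : Fin N) (ℓ : Fin (N ^ k)) :
    (prependDigit (i, ℓ) : ℕ) = i * N ^ k + ℓ := by
  simp [prependDigit, finProdFinEquiv, add_comm, mul_comm]

lemma appendDigit_prependDigit (i : Fin N) (ℓ : Fin (N ^ k)) (d : Fin N) :
    appendDigit (prependDigit (i, ℓ), d) = prependDigit (i, appendDigit (ℓ, d)) := by
  ext
  simp only [appendDigit_val, prependDigit_val]
  ring

lemma sum_appendDigit (f : Fin (N ^ (k + 1)) → ℝ) :
    ∑ j, f j = ∑ ℓ, ∑ d, f (appendDigit (ℓ, d)) := by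
  rw [← appendDigit.sum_comp, Fintype.sum_prod_type]

lemma scalingMatrix_prependDigit_appendDigit (s : Fin N → Fin (N ^ (k + 1)) → ℝ)
    (i d : Fin N) (ℓ ℓ' : Fin (N ^ k)) :
    scalingMatrix N k s (prependDigit (i, ℓ)) (appendDigit (ℓ', d)) =
      if ℓ' = ℓ then s i (appendDigit (ℓ', d)) else 0 := by
  have hmod : (prependDigit (i, ℓ) : ℕ) % N ^ k = ℓ := by
    rw [prependDigit_val, Nat.mul_add_mod_of_lt ℓ.isLt]
  have hdiv : (prependDigit (i, ℓ) : ℕ) / N ^ k = i := by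
    rw [prependDigit_val, mul_comm, Nat.mul_add_div ℓ.pos, Nat.div_eq_of_lt ℓ.isLt, add_zero]
  have hcol : ℓ * N ≤ (appendDigit (ℓ', d) : ℕ) ∧ (appendDigit (ℓ', d) : ℕ) < (ℓ + 1) * N ↔
      ℓ' = ℓ := by
    have hdigit : (appendDigit (ℓ', d) : ℕ) / N = ℓ' := by
      rw [appendDigit_val, mul_comm, Nat.mul_add_div d.pos, Nat.div_eq_of_lt d.isLt, add_zero]
    rw [Fin.ext_iff, ← hdigit, Nat.div_eq_iff d.pos, add_mul, one_mul]
    have := d.pos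
    omega
  simp only [scalingMatrix, of_apply, hmod, hdiv, hcol, Fin.eta]

lemma scalingMatrix_mulVec_prependDigit (s : Fin N → Fin (N ^ (k + 1)) → ℝ)
    (v : Fin (N ^ (k + 1)) → ℝ) (i : Fin N) (ℓ : Fin (N ^ k)) :
    (scalingMatrix N k s *ᵥ v) (prependDigit (i, ℓ)) =
      ∑ d, s i (appendDigit (ℓ, d)) * v (appendDigit (ℓ, d)) := by
  simp only [mulVec, dotProduct, sum_appendDigit, scalingMatrix_prependDigit_appendDigit, ite_mul,
    zero_mul, Finset.sum_ite_irrel, Finset.sum_const_zero, Finset.sum_ite_eq', Finset.mem_univ,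
    if_true]

lemma scalingMatrix_nonneg {s : Fin N → Fin (N ^ (k + 1)) → ℝ} (hs : ∀ i j, 0 ≤ s i j)
    (r j : Fin (N ^ (k + 1))) : 0 ≤ scalingMatrix N k s r j := by
  simp only [scalingMatrix, of_apply]
  split_ifs
  exacts [hs _ _, le_rfl]

lemma scalingMatrix_mono {s t : Fin N → Fin (N ^ (k + 1)) → ℝ} (hst : ∀ i j, s i j ≤ t i j)
    (r j : Fin (N ^ (k + 1))) : scalingMatrix N k s r j ≤ scalingMatrix N k t r j := by
  simp only [scalingMatrix, of_apply]
  split_ifs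
  exacts [hst _ _, le_rfl]

/-- The sum of a vector indexed by the cells of level `k + 1` over the `N` cells that make up each
cell of level `k`; it intertwines scaling matrices of consecutive levels. -/
def childSum (v : Fin (N ^ (k + 1)) → ℝ) (ℓ : Fin (N ^ k)) : ℝ := ∑ d, v (appendDigit (ℓ, d))

lemma childSum_mono {v w : Fin (N ^ (k + 1)) → ℝ} (h : v ≤ w) : childSum v ≤ childSum w :=
  fun _ => Finset.sum_le_sum fun _ _ => h _

lemma childSum_smul (c : ℝ) (v : Fin (N ^ (k + 1)) → ℝ) : childSum (c • v) = c • childSum v :=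
  funext fun _ => (Finset.mul_sum _ _ _).symm

lemma childSum_pos [NeZero N] {v : Fin (N ^ (k + 1)) → ℝ} (hv : ∀ j, 0 < v j) (ℓ : Fin (N ^ k)) :
    0 < childSum v ℓ :=
  Finset.sum_pos (fun _ _ => hv _) Finset.univ_nonempty

lemma childSum_nonneg {v : Fin (N ^ (k + 1)) → ℝ} (hv : 0 ≤ v) : 0 ≤ childSum v :=
  fun _ => Finset.sum_nonneg fun _ _ => hv _

lemma childSum_ne_zero {v : Fin (N ^ (k + 1)) → ℝ} (hv : 0 ≤ v) (hv0 : v ≠ 0) :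
    childSum v ≠ 0 := by
  contrapose! hv0
  ext j
  obtain ⟨⟨ℓ, d⟩, rfl⟩ := appendDigit.surjective j
  have hsum : ∑ e, v (appendDigit (ℓ, e)) = 0 := congrFun hv0 ℓ
  exact (Finset.sum_eq_zero_iff_of_nonneg fun e _ => hv (appendDigit (ℓ, e))).1 hsum d
    (Finset.mem_univ d)

lemma childSum_scalingMatrix_mulVec_prependDigit (t : Fin N → Fin (N ^ (k + 1 + 1)) → ℝ)
    (v : Fin (N ^ (k + 1 + 1)) → ℝ) (i : Fin N) (ℓ : Fin (N ^ k)) :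
    childSum (scalingMatrix N (k + 1) t *ᵥ v) (prependDigit (i, ℓ)) =
      ∑ d, ∑ e, t i (appendDigit (appendDigit (ℓ, d), e)) *
        v (appendDigit (appendDigit (ℓ, d), e)) := by
  simp only [childSum, appendDigit_prependDigit, scalingMatrix_mulVec_prependDigit]

lemma scalingMatrix_mulVec_childSum_prependDigit (s : Fin N → Fin (N ^ (k + 1)) → ℝ)
    (v : Fin (N ^ (k + 1 + 1)) → ℝ) (i : Fin N) (ℓ : Fin (N ^ k)) :
    (scalingMatrix N k s *ᵥ childSum v) (prependDigit (i, ℓ)) =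
      ∑ d, ∑ e, s i (appendDigit (ℓ, d)) * v (appendDigit (appendDigit (ℓ, d), e)) := by
  simp only [scalingMatrix_mulVec_prependDigit, childSum, Finset.mul_sum]

variable {s : Fin N → Fin (N ^ (k + 1)) → ℝ} {t : Fin N → Fin (N ^ (k + 1 + 1)) → ℝ}

lemma childSum_scalingMatrix_mulVec_le (h : ∀ i j d, t i (appendDigit (j, d)) ≤ s i j)
    {v : Fin (N ^ (k + 1 + 1)) → ℝ} (hv : 0 ≤ v) :
    childSum (scalingMatrix N (k + 1) t *ᵥ v) ≤ scalingMatrix N k s *ᵥ childSum v := by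
  intro r
  obtain ⟨⟨i, ℓ⟩, rfl⟩ := prependDigit.surjective r
  rw [childSum_scalingMatrix_mulVec_prependDigit, scalingMatrix_mulVec_childSum_prependDigit]
  gcongr
  exacts [hv _, h _ _ _]

lemma scalingMatrix_mulVec_childSum_le (h : ∀ i j d, s i j ≤ t i (appendDigit (j, d)))
    {v : Fin (N ^ (k + 1 + 1)) → ℝ} (hv : 0 ≤ v) :
    scalingMatrix N k s *ᵥ childSum v ≤ childSum (scalingMatrix N (k + 1) t *ᵥ v) := by
  intro r
  obtain ⟨⟨i, ℓ⟩, rfl⟩ := prependDigit.surjective r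
  rw [childSum_scalingMatrix_mulVec_prependDigit, scalingMatrix_mulVec_childSum_prependDigit]
  gcongr
  exacts [hv _, h _ _ _]

lemma matrixSpectralRadius_scalingMatrix_succ_le [NeZero N] (ht : ∀ i j, 0 ≤ t i j)
    (h : ∀ i j d, t i (appendDigit (j, d)) ≤ s i j) :
    matrixSpectralRadius (scalingMatrix N (k + 1) t) ≤
      matrixSpectralRadius (scalingMatrix N k s) := by
  have hs : ∀ i j, 0 ≤ s i j := fun i j => (ht _ _).trans (h i j 0)
  obtain ⟨u, hu, hu0, hAu⟩ := exists_matrixSpectralRadius_smul_le_mulVec (scalingMatrix_nonneg ht)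
  refine le_matrixSpectralRadius_of_smul_le_mulVec (scalingMatrix_nonneg hs) (childSum_nonneg hu)
    (childSum_ne_zero hu hu0) ?_
  rw [← childSum_smul]
  exact (childSum_mono hAu).trans (childSum_scalingMatrix_mulVec_le h hu)

lemma matrixSpectralRadius_scalingMatrix_le_succ [NeZero N] (hs : ∀ i j, 0 ≤ s i j)
    (h : ∀ i j d, s i j ≤ t i (appendDigit (j, d))) :
    matrixSpectralRadius (scalingMatrix N k s) ≤
      matrixSpectralRadius (scalingMatrix N (k + 1) t) := by
  have ht : ∀ i j, 0 ≤ t i j := fun i j => by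
    obtain ⟨⟨ℓ, d⟩, rfl⟩ := appendDigit.surjective j
    exact (hs i ℓ).trans (h i ℓ d)
  refine le_of_forall_gt_imp_ge_of_dense fun θ hθ => ?_
  obtain ⟨v, hv, hAv⟩ :=
    exists_pos_mulVec_le_smul_of_matrixSpectralRadius_lt (scalingMatrix_nonneg ht) hθ
  refine matrixSpectralRadius_le_of_mulVec_le_smul (scalingMatrix_nonneg hs) (childSum_pos hv) ?_
  rw [← childSum_smul]
  exact (scalingMatrix_mulVec_childSum_le h fun j => (hv j).le).trans (childSum_mono hAv)

end ScalingMatrix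

/-! ### Variation -/

section Variation

open Set

section

variable {α E : Type*} [LinearOrder α] [SeminormedAddCommGroup E] {f g : α → E} {s : Set α}

lemma eVariationOn_add_le (f g : α → E) (s : Set α) :
    eVariationOn (f + g) s ≤ eVariationOn f s + eVariationOn g s := by
  refine iSup_le fun ⟨n, u, hu, us⟩ => ?_
  calc ∑ i ∈ Finset.range n, edist ((f + g) (u (i + 1))) ((f + g) (u i))
      ≤ ∑ i ∈ Finset.range n,
          (edist (f (u (i + 1))) (f (u i)) + edist (g (u (i + 1))) (g (u i))) :=
        Finset.sum_le_sum fun _ _ => edist_add_add_le _ _ _ _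
    _ ≤ eVariationOn f s + eVariationOn g s := by
        rw [Finset.sum_add_distrib]
        exact add_le_add (eVariationOn.sum_le hu us) (eVariationOn.sum_le hu us)

lemma eVariationOn_neg (f : α → E) (s : Set α) : eVariationOn (-f) s = eVariationOn f s := by
  simp only [eVariationOn, Pi.neg_apply, edist_neg_neg]

lemma boundedVariationOn_add (hf : BoundedVariationOn f s) (hg : BoundedVariationOn g s) :
    BoundedVariationOn (f + g) s :=
  ne_top_of_le_ne_top (ENNReal.add_ne_top.2 ⟨hf, hg⟩) (eVariationOn_add_le f g s)

lemma boundedVariationOn_sub (hf : BoundedVariationOn f s) (hg : BoundedVariationOn g s) :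
    BoundedVariationOn (f - g) s :=
  sub_eq_add_neg f g ▸ boundedVariationOn_add hf ((eVariationOn_neg g s).trans_ne hg)

end

lemma boundedVariationOn_inv {α : Type*} [LinearOrder α] {f : α → ℝ} {s : Set α} {c : ℝ}
    (hf : BoundedVariationOn f s) (hc : 0 < c) (hfc : ∀ x ∈ s, c ≤ |f x|) :
    BoundedVariationOn f⁻¹ s := by
  have hinv : LipschitzOnWith ⟨(c * c)⁻¹, by positivity⟩ Inv.inv {y : ℝ | c ≤ |y|} := by
    refine LipschitzOnWith.of_dist_le_mul fun x hx y hy => ?_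
    have hx0 : x ≠ 0 := abs_pos.1 (hc.trans_le hx)
    have hy0 : y ≠ 0 := abs_pos.1 (hc.trans_le hy)
    rw [Real.dist_eq, Real.dist_eq, inv_sub_inv hx0 hy0, abs_div, abs_mul, abs_sub_comm,
      div_eq_inv_mul]
    gcongr
    exact inv_anti₀ (mul_pos hc hc) (mul_le_mul hx hy hc.le (abs_nonneg x))
  exact hinv.comp_boundedVariationOn hfc hf

lemma natCast_div_mem_Icc {c M : ℕ} (hc : c ≤ M) : (c : ℝ) / M ∈ Icc (0 : ℝ) 1 :=
  ⟨by positivity, div_le_one_of_le₀ (by exact_mod_cast hc) (by positivity)⟩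

lemma monotone_natCast_div (M : ℕ) : Monotone fun j : ℕ => (j : ℝ) / M :=
  fun _ _ hab => div_le_div_of_nonneg_right (Nat.cast_le.2 hab) M.cast_nonneg

lemma floor_mul_natCast_le {t : ℝ} (ht : t ∈ Icc (0 : ℝ) 1) (M : ℕ) : ⌊t * M⌋₊ ≤ M :=
  Nat.floor_le_of_le (mul_le_of_le_one_left M.cast_nonneg ht.2)

lemma tendsto_comp_floor_mul_div {f : ℝ → ℝ} (hf : ContinuousOn f (Icc 0 1)) {t : ℝ}
    (ht : t ∈ Icc (0 : ℝ) 1) :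
    Tendsto (fun M : ℕ => f ((⌊t * M⌋₊ : ℝ) / M)) atTop (𝓝 (f t)) :=
  (hf t ht).tendsto.comp <| tendsto_nhdsWithin_iff.2
    ⟨(tendsto_nat_floor_mul_div_atTop ht.1).comp tendsto_natCast_atTop_atTop,
      .of_forall fun M => natCast_div_mem_Icc (floor_mul_natCast_le ht M)⟩

-- The step functions `t ↦ f (⌊t M⌋ / M)` converge pointwise to `f`, and the variation is lower
-- semicontinuous.
lemma tendsto_sum_abs_sub_atTop {f : ℝ → ℝ} (hf : ContinuousOn f (Icc 0 1))
    (h : eVariationOn f (Icc 0 1) = ⊤) :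
    Tendsto (fun M : ℕ => ∑ c : Fin M, |f (((c : ℝ) + 1) / M) - f (c / M)|) atTop atTop := by
  refine tendsto_atTop.2 fun v => ?_
  have hlsc := eVariationOn.lowerSemicontinuous_aux (fun t ht => tendsto_comp_floor_mul_div hf ht)
    (h ▸ ENNReal.ofReal_lt_top : ENNReal.ofReal v < eVariationOn f (Icc 0 1))
  filter_upwards [hlsc] with M hM
  have hstep : eVariationOn (f ∘ fun t : ℝ => (⌊t * M⌋₊ : ℝ) / M) (Icc 0 1) ≤
      eVariationOn f ((fun j : ℕ => (j : ℝ) / M) '' Iic M) :=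
    eVariationOn.comp_le_of_monotoneOn f _ (fun a _ b _ hab => by gcongr)
      fun t ht => ⟨_, floor_mul_natCast_le ht M, rfl⟩
  rw [eVariationOn.image_range_of_monotone f (monotone_natCast_div M)] at hstep
  have hsum := (hM.trans_le hstep).le
  simp only [edist_dist, Real.dist_eq] at hsum
  rw [← ENNReal.ofReal_sum_of_nonneg fun i _ => abs_nonneg _,
    ENNReal.ofReal_le_ofReal_iff (Finset.sum_nonneg fun i _ => abs_nonneg _)] at hsum
  simpa only [Finset.sum_range, abs_sub_comm, Nat.cast_add, Nat.cast_one] using hsum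

end Variation

/-! ### Oscillation on the cells of a uniform partition -/

section Oscillation

open Set

variable {M K : ℕ}

/-- The affine contraction of `[0, 1]` onto the `c`-th of the `M` cells of equal length into which
`[0, 1]` splits. -/
noncomputable def cellMap (c : Fin M) (t : ℝ) : ℝ := (c + t) / M

/-- The `c`-th of the `M` closed cells of equal length of `[0, 1]`. -/
def cell (c : Fin M) : Set ℝ := Icc ((c : ℝ) / M) (((c : ℝ) + 1) / M)

lemma cell_subset_Icc (c : Fin M) : cell c ⊆ Icc 0 1 :=
  Icc_subset_Icc (natCast_div_mem_Icc c.isLt.le).1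
    (by exact_mod_cast (natCast_div_mem_Icc c.isLt).2)

lemma left_mem_cell (c : Fin M) : (c : ℝ) / M ∈ cell c :=
  left_mem_Icc.2 (by gcongr; exact le_add_of_nonneg_right zero_le_one)

lemma right_mem_cell (c : Fin M) : ((c : ℝ) + 1) / M ∈ cell c :=
  right_mem_Icc.2 (by gcongr; exact le_add_of_nonneg_right zero_le_one)

lemma exists_mem_cell (hM : 0 < M) {t : ℝ} (ht : t ∈ Icc (0 : ℝ) 1) : ∃ c : Fin M, t ∈ cell c := by
  have hM' : (0 : ℝ) < M := Nat.cast_pos.2 hM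
  rcases ht.2.eq_or_lt with rfl | ht1
  · refine ⟨⟨M - 1, Nat.sub_lt hM one_pos⟩, ?_⟩
    simp only [cell, Nat.cast_pred hM, sub_add_cancel, div_self hM'.ne', mem_Icc, le_refl,
      and_true, div_le_one hM']
    exact sub_le_self _ zero_le_one
  · refine ⟨⟨⌊t * M⌋₊, (Nat.floor_lt (mul_nonneg ht.1 hM'.le)).2 (mul_lt_of_lt_one_left hM' ht1)⟩,
      (div_le_iff₀ hM').2 (Nat.floor_le (mul_nonneg ht.1 hM'.le)),
      (le_div_iff₀ hM').2 (Nat.lt_floor_add_one _).le⟩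

lemma cellMap_injective (c : Fin M) : Function.Injective (cellMap c) := fun a b hab => by
  have hM : (M : ℝ) ≠ 0 := Nat.cast_ne_zero.2 c.pos.ne'
  simpa only [cellMap, div_left_inj' hM, add_right_inj] using hab

lemma monotone_cellMap (c : Fin M) : Monotone (cellMap c) := fun a b hab => by
  unfold cellMap
  gcongr

lemma continuous_cellMap (c : Fin M) : Continuous (cellMap c) := by
  unfold cellMap
  fun_prop

lemma image_cellMap (c : Fin M) : cellMap c '' Icc 0 1 = cell c := by
  have h : cellMap c = (fun x => x * (M : ℝ)⁻¹) ∘ fun t => (c : ℝ) + t := rfl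
  rw [h, image_comp, image_const_add_Icc, image_mul_right_Icc (by simp) (by positivity), add_zero]
  rfl

lemma cellMap_mem_cell (c : Fin M) {t : ℝ} (ht : t ∈ Icc (0 : ℝ) 1) : cellMap c t ∈ cell c :=
  image_cellMap c ▸ mem_image_of_mem _ ht

lemma mapsTo_cellMap (c : Fin M) : MapsTo (cellMap c) (Icc 0 1) (Icc 0 1) :=
  fun _ ht => cell_subset_Icc c (cellMap_mem_cell c ht)

lemma comp_cellMap_eq {n : ℕ} {r : Fin n} {c : Fin M} {j : Fin K} (hn : n = M * K)
    (hr : (r : ℕ) = c * K + j) (F : ℝ → ℝ) : F ∘ cellMap r = F ∘ cellMap c ∘ cellMap j := by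
  have hK : (K : ℝ) ≠ 0 := Nat.cast_ne_zero.2 j.pos.ne'
  funext t
  simp only [Function.comp_apply, cellMap, hn, hr, Nat.cast_add, Nat.cast_mul]
  congr 1
  field_simp
  ring

lemma image_cellMap_cell {n : ℕ} {r : Fin n} {c : Fin M} {j : Fin K} (hn : n = M * K)
    (hr : (r : ℕ) = c * K + j) : cellMap c '' cell j = cell r := by
  rw [← image_cellMap, ← image_cellMap, ← image_comp]
  exact congrArg (· '' _) (comp_cellMap_eq hn hr id).symm

lemma eVariationOn_comp_cellMap (F : ℝ → ℝ) (c : Fin M) :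
    eVariationOn (F ∘ cellMap c) (Icc 0 1) = eVariationOn F (cell c) := by
  rw [← image_cellMap, eVariationOn.comp_eq_of_monotoneOn F _ ((monotone_cellMap c).monotoneOn _)]

lemma boundedVariationOn_comp_cellMap {F : ℝ → ℝ} (hF : BoundedVariationOn F (Icc 0 1))
    (c : Fin M) : BoundedVariationOn (F ∘ cellMap c) (Icc 0 1) :=
  (eVariationOn_comp_cellMap F c).trans_ne (hF.mono (cell_subset_Icc c))

lemma toReal_eVariationOn_comp_cellMap_le {F : ℝ → ℝ} (hF : BoundedVariationOn F (Icc 0 1))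
    (c : Fin M) :
    (eVariationOn (F ∘ cellMap c) (Icc 0 1)).toReal ≤ (eVariationOn F (Icc 0 1)).toReal :=
  ENNReal.toReal_mono hF <| (eVariationOn_comp_cellMap F c).trans_le <|
    eVariationOn.mono F (cell_subset_Icc c)

lemma continuousOn_comp_cellMap {F : ℝ → ℝ} (hF : ContinuousOn F (Icc 0 1)) (c : Fin M) :
    ContinuousOn (F ∘ cellMap c) (Icc 0 1) :=
  hF.comp (continuous_cellMap c).continuousOn (mapsTo_cellMap c)

lemma sum_eVariationOn_cell (F : ℝ → ℝ) (hM : 0 < M) :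
    ∑ c : Fin M, eVariationOn F (cell c) = eVariationOn F (Icc 0 1) := by
  have hM' : (M : ℝ) ≠ 0 := Nat.cast_ne_zero.2 hM.ne'
  have h := eVariationOn.sum' F (monotone_natCast_div M) (n := M)
  simpa only [cell, Finset.sum_range, Nat.cast_zero, zero_div, div_self hM', Nat.cast_add,
    Nat.cast_one] using h

lemma exists_forall_cell_of_nhdsWithin {P : Set ℝ → Prop} (hP : ∀ s t, s ⊆ t → P t → P s)
    (h : ∀ x ∈ Icc (0 : ℝ) 1, ∃ U ∈ 𝓝[Icc 0 1] x, P U) :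
    ∃ M : ℕ, 0 < M ∧ ∀ c : Fin M, P (cell c) := by
  have hball : ∀ x ∈ Icc (0 : ℝ) 1, ∃ r > 0, P (Metric.ball x r ∩ Icc 0 1) := fun x hx => by
    obtain ⟨U, hU, hPU⟩ := h x hx
    obtain ⟨r, hr, hrU⟩ := Metric.mem_nhdsWithin_iff.1 hU
    exact ⟨r, hr, hP _ _ hrU hPU⟩
  choose! r hr0 hr using hball
  obtain ⟨δ, hδ, hδr⟩ := lebesgue_number_lemma_of_metric (c := fun x : Icc (0 : ℝ) 1 =>
    Metric.ball x.1 (r x)) isCompact_Icc (fun _ => Metric.isOpen_ball)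
    fun x hx => mem_iUnion.2 ⟨⟨x, hx⟩, Metric.mem_ball_self (hr0 x hx)⟩
  obtain ⟨m, hm⟩ := exists_nat_one_div_lt hδ
  refine ⟨m + 1, m.succ_pos, fun c => ?_⟩
  obtain ⟨⟨x, hx⟩, hsub⟩ := hδr _ (cell_subset_Icc c (left_mem_cell c))
  refine hP _ (Metric.ball x (r x) ∩ Icc 0 1)
    (fun t (ht : t ∈ cell c) => ⟨hsub ?_, cell_subset_Icc c ht⟩) (hr x hx)
  obtain ⟨ht1, ht2⟩ := ht
  rw [add_div] at ht2
  rw [Metric.mem_ball, Real.dist_eq, abs_lt]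
  push_cast at *
  constructor <;> linarith

/-- The oscillation `sup F - inf F` of `F` on a cell. -/
noncomputable def osc (F : ℝ → ℝ) (c : Fin M) : ℝ := Metric.diam (F '' cell c)

/-- The sum of the oscillations of `F` on the `M` cells of equal length of `[0, 1]`. -/
noncomputable def oscSum (F : ℝ → ℝ) (M : ℕ) : ℝ := ∑ c : Fin M, osc F c

lemma oscSum_nonneg (F : ℝ → ℝ) (M : ℕ) : 0 ≤ oscSum F M :=
  Finset.sum_nonneg fun _ _ => Metric.diam_nonneg

lemma abs_sub_le_osc {F : ℝ → ℝ} (hF : Bornology.IsBounded (F '' Icc 0 1)) {c : Fin M} {u v : ℝ}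
    (hu : u ∈ cell c) (hv : v ∈ cell c) : |F u - F v| ≤ osc F c :=
  Metric.dist_le_diam_of_mem (hF.subset (image_mono (cell_subset_Icc c)))
    (mem_image_of_mem F hu) (mem_image_of_mem F hv)

lemma osc_le {F : ℝ → ℝ} {c : Fin M} {C : ℝ} (hC : 0 ≤ C)
    (h : ∀ u ∈ cell c, ∀ v ∈ cell c, |F u - F v| ≤ C) : osc F c ≤ C := by
  refine Metric.diam_le_of_forall_dist_le hC ?_
  rintro _ ⟨u, hu, rfl⟩ _ ⟨v, hv, rfl⟩
  exact h u hu v hv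

lemma oscSum_mul (F : ℝ → ℝ) (M K : ℕ) :
    oscSum F (M * K) = ∑ c : Fin M, oscSum (F ∘ cellMap c) K := by
  simp only [oscSum, ← finProdFinEquiv.sum_comp, Fintype.sum_prod_type]
  refine Finset.sum_congr rfl fun c _ => Finset.sum_congr rfl fun j _ => ?_
  have hval : (finProdFinEquiv (c, j) : ℕ) = c * K + j := by
    rw [finProdFinEquiv_apply_val, mul_comm, add_comm]
  rw [osc, osc, image_comp, image_cellMap_cell rfl hval]

lemma oscSum_le_eVariationOn {F : ℝ → ℝ} (hF : BoundedVariationOn F (Icc 0 1)) (M : ℕ) :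
    oscSum F M ≤ (eVariationOn F (Icc 0 1)).toReal := by
  rcases M.eq_zero_or_pos with rfl | hM
  · simp [oscSum]
  have hcell (c : Fin M) : BoundedVariationOn F (cell c) := hF.mono (cell_subset_Icc c)
  rw [← sum_eVariationOn_cell F hM, ENNReal.toReal_sum fun c _ => hcell c]
  exact Finset.sum_le_sum fun c _ =>
    osc_le ENNReal.toReal_nonneg fun u hu v hv => (hcell c).dist_le hu hv

lemma isBounded_image_of_boundedVariationOn {F : ℝ → ℝ} {s : Set ℝ} (hF : BoundedVariationOn F s) :
    Bornology.IsBounded (F '' s) := by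
  refine Metric.isBounded_iff.2 ⟨(eVariationOn F s).toReal, ?_⟩
  rintro _ ⟨u, hu, rfl⟩ _ ⟨v, hv, rfl⟩
  exact hF.dist_le hu hv

lemma isBounded_image_of_continuousOn {F : ℝ → ℝ} (hF : ContinuousOn F (Icc 0 1)) :
    Bornology.IsBounded (F '' Icc 0 1) :=
  (isCompact_Icc.image_of_continuousOn hF).isBounded

lemma tendsto_oscSum_atTop {F : ℝ → ℝ} (hF : ContinuousOn F (Icc 0 1))
    (h : eVariationOn F (Icc 0 1) = ⊤) : Tendsto (oscSum F) atTop atTop :=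
  tendsto_atTop_mono (fun _ => Finset.sum_le_sum fun c _ =>
    abs_sub_le_osc (isBounded_image_of_continuousOn hF) (right_mem_cell c) (left_mem_cell c))
    (tendsto_sum_abs_sub_atTop hF h)

section Affine

variable {F G s q : ℝ → ℝ} {B σ : ℝ}

lemma abs_sub_sub_mul_sub_le (hs : BoundedVariationOn s (Icc 0 1))
    (hq : BoundedVariationOn q (Icc 0 1)) (hB : ∀ t ∈ Icc (0 : ℝ) 1, |G t| ≤ B)
    (hF : ∀ t ∈ Icc (0 : ℝ) 1, F t = s t * G t + q t) {c : Fin M} {u v : ℝ}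
    (hu : u ∈ cell c) (hv : v ∈ cell c) :
    |F u - F v - s u * (G u - G v)| ≤ B * osc s c + osc q c := by
  have hu' := cell_subset_Icc c hu
  have hv' := cell_subset_Icc c hv
  have hB0 : 0 ≤ B := (abs_nonneg _).trans (hB v hv')
  calc |F u - F v - s u * (G u - G v)| = |G v * (s u - s v) + (q u - q v)| := by
        rw [hF u hu', hF v hv']; ring_nf
    _ ≤ |G v| * |s u - s v| + |q u - q v| := by
        rw [← abs_mul]
        exact abs_add_le _ _
    _ ≤ B * osc s c + osc q c := by
        gcongr
        · exact hB v hv'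
        · exact abs_sub_le_osc (isBounded_image_of_boundedVariationOn hs) hu hv
        · exact abs_sub_le_osc (isBounded_image_of_boundedVariationOn hq) hu hv

lemma sum_mul_osc_add_osc_le (hs : BoundedVariationOn s (Icc 0 1))
    (hq : BoundedVariationOn q (Icc 0 1)) (hB : 0 ≤ B) (M : ℕ) :
    ∑ c : Fin M, (B * osc s c + osc q c) ≤
      B * (eVariationOn s (Icc 0 1)).toReal + (eVariationOn q (Icc 0 1)).toReal := by
  rw [Finset.sum_add_distrib, ← Finset.mul_sum]
  exact add_le_add (mul_le_mul_of_nonneg_left (oscSum_le_eVariationOn hs M) hB)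
    (oscSum_le_eVariationOn hq M)

variable (hs : BoundedVariationOn s (Icc 0 1)) (hq : BoundedVariationOn q (Icc 0 1))
  (hB : ∀ t ∈ Icc (0 : ℝ) 1, |G t| ≤ B) (hF : ∀ t ∈ Icc (0 : ℝ) 1, F t = s t * G t + q t)
include hs hq hB hF

lemma oscSum_le_of_eq_mul_add (hG : ContinuousOn G (Icc 0 1))
    (hσ : ∀ t ∈ Icc (0 : ℝ) 1, |s t| ≤ σ) (M : ℕ) :
    oscSum F M ≤ σ * oscSum G M +
      (B * (eVariationOn s (Icc 0 1)).toReal + (eVariationOn q (Icc 0 1)).toReal) := by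
  have h0 : (0 : ℝ) ∈ Icc (0 : ℝ) 1 := left_mem_Icc.2 zero_le_one
  have hσ0 : 0 ≤ σ := (abs_nonneg _).trans (hσ 0 h0)
  have hosc (c : Fin M) : osc F c ≤ σ * osc G c + (B * osc s c + osc q c) := by
    have hpair : ∀ u ∈ cell c, ∀ v ∈ cell c,
        |F u - F v| ≤ σ * osc G c + (B * osc s c + osc q c) := fun u hu v hv => by
      have hmul : |s u * (G u - G v)| ≤ σ * osc G c := by
        rw [abs_mul]
        exact mul_le_mul (hσ u (cell_subset_Icc c hu))
          (abs_sub_le_osc (isBounded_image_of_continuousOn hG) hu hv) (abs_nonneg _) hσ0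
      linarith [abs_sub_abs_le_abs_sub (F u - F v) (s u * (G u - G v)),
        abs_sub_sub_mul_sub_le hs hq hB hF hu hv]
    exact osc_le ((abs_nonneg _).trans (hpair _ (left_mem_cell c) _ (left_mem_cell c))) hpair
  calc oscSum F M ≤ ∑ c : Fin M, (σ * osc G c + (B * osc s c + osc q c)) :=
        Finset.sum_le_sum fun c _ => hosc c
    _ ≤ _ := by
        rw [Finset.sum_add_distrib, ← Finset.mul_sum]
        exact add_le_add_right
          (sum_mul_osc_add_osc_le hs hq ((abs_nonneg _).trans (hB 0 h0)) M) _

open scoped Pointwise in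
lemma le_oscSum_of_eq_mul_add (hFc : ContinuousOn F (Icc 0 1)) (hσ0 : 0 ≤ σ)
    (hσ : ∀ t ∈ Icc (0 : ℝ) 1, σ ≤ |s t|) (M : ℕ) :
    σ * oscSum G M -
      (B * (eVariationOn s (Icc 0 1)).toReal + (eVariationOn q (Icc 0 1)).toReal) ≤
        oscSum F M := by
  have hB0 : 0 ≤ B := (abs_nonneg _).trans (hB 0 (left_mem_Icc.2 zero_le_one))
  have hosc (c : Fin M) : σ * osc G c ≤ osc F c + (B * osc s c + osc q c) := by
    have hpair : ∀ u ∈ cell c, ∀ v ∈ cell c,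
        |σ * G u - σ * G v| ≤ osc F c + (B * osc s c + osc q c) := fun u hu v hv => by
      have hmul : |σ * G u - σ * G v| ≤ |s u * (G u - G v)| := by
        rw [← mul_sub, abs_mul, abs_mul, abs_of_nonneg hσ0]
        exact mul_le_mul_of_nonneg_right (hσ u (cell_subset_Icc c hu)) (abs_nonneg _)
      linarith [abs_sub_abs_le_abs_sub (s u * (G u - G v)) (F u - F v),
        abs_sub_comm (F u - F v) (s u * (G u - G v)), abs_sub_sub_mul_sub_le hs hq hB hF hu hv,
        abs_sub_le_osc (isBounded_image_of_continuousOn hFc) hu hv]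
    have hdiam : osc (fun t => σ * G t) c = σ * osc G c := by
      have himage : (fun t => σ * G t) '' cell c = σ • G '' cell c := by
        rw [← image_smul, image_image]
        rfl
      rw [osc, himage, diam_smul₀, Real.norm_of_nonneg hσ0, osc]
    exact hdiam ▸
      osc_le ((abs_nonneg _).trans (hpair _ (left_mem_cell c) _ (left_mem_cell c))) hpair
  have hsum : σ * oscSum G M ≤ oscSum F M + ∑ c : Fin M, (B * osc s c + osc q c) := by
    rw [oscSum, oscSum, Finset.mul_sum, ← Finset.sum_add_distrib]
    exact Finset.sum_le_sum fun c _ => hosc c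
  linarith [sum_mul_osc_add_osc_le hs hq hB0 M]

end Affine

end Oscillation

/-! ### Self-affine functions on the unit interval -/

/-- Data of a self-affine functional equation `F((i + t)/N) = S_i(t) F(t) + q_i(t)`, `i < N`,
on `[0, 1]` with coefficients of bounded variation: the form that the invariance of the graph of
a fractal interpolation function takes after rescaling `[x_0, x_N]` to `[0, 1]`. -/
structure SelfAffine (F : ℝ → ℝ) (N : ℕ) where
  S : Fin N → ℝ → ℝ
  q : Fin N → ℝ → ℝ
  pos : 0 < N
  continuousOn_F : ContinuousOn F (Set.Icc 0 1)
  continuousOn_S : ∀ i, ContinuousOn (S i) (Set.Icc 0 1)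
  bv_S : ∀ i, BoundedVariationOn (S i) (Set.Icc 0 1)
  bv_q : ∀ i, BoundedVariationOn (q i) (Set.Icc 0 1)
  map_eq : ∀ i, ∀ t ∈ Set.Icc (0 : ℝ) 1, F (cellMap i t) = S i t * F t + q i t

namespace SelfAffine

open Set

variable {F : ℝ → ℝ} {N M : ℕ}

/-- Composition of two functional equations of the same function: the cell `i * M + j` of level
`N * M` is reached by the `j`-th map of `A'` followed by the `i`-th map of `A`. -/
noncomputable def comp (A : SelfAffine F N) (A' : SelfAffine F M) : SelfAffine F (N * M) where
  S r := (A.S r.divNat ∘ cellMap r.modNat) * A'.S r.modNat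
  q r := (A.S r.divNat ∘ cellMap r.modNat) * A'.q r.modNat + A.q r.divNat ∘ cellMap r.modNat
  pos := Nat.mul_pos A.pos A'.pos
  continuousOn_F := A.continuousOn_F
  continuousOn_S _ := (continuousOn_comp_cellMap (A.continuousOn_S _) _).mul (A'.continuousOn_S _)
  bv_S _ := (boundedVariationOn_comp_cellMap (A.bv_S _) _).mul (A'.bv_S _)
  bv_q _ := boundedVariationOn_add ((boundedVariationOn_comp_cellMap (A.bv_S _) _).mul (A'.bv_q _))
    (boundedVariationOn_comp_cellMap (A.bv_q _) _)
  map_eq r t ht := by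
    have hr : (r : ℕ) = r.divNat * M + r.modNat := (Nat.div_add_mod' _ _).symm
    have hcomp := congrFun (comp_cellMap_eq rfl hr F) t
    simp only [Function.comp_apply] at hcomp
    rw [hcomp, A.map_eq _ _ (mapsTo_cellMap _ ht), A'.map_eq _ _ ht]
    simp only [Pi.mul_apply, Pi.add_apply, Function.comp_apply]
    ring

/-- The functional equation `F = 1 * F + 0`, the zeroth iterate of any functional equation. -/
def trivial (hF : ContinuousOn F (Icc 0 1)) : SelfAffine F 1 where
  S _ _ := 1
  q _ _ := 0
  pos := one_pos
  continuousOn_F := hF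
  continuousOn_S _ := continuousOn_const
  bv_S _ := by simp [BoundedVariationOn, eVariationOn]
  bv_q _ := by simp [BoundedVariationOn, eVariationOn]
  map_eq _ _ _ := by simp [cellMap]

lemma abs_comp_S_le {A : SelfAffine F N} {A' : SelfAffine F M} {a a' : ℝ}
    (hA : ∀ i, ∀ t ∈ Icc (0 : ℝ) 1, |A.S i t| ≤ a) (hA' : ∀ i, ∀ t ∈ Icc (0 : ℝ) 1, |A'.S i t| ≤ a')
    (r : Fin (N * M)) {t : ℝ} (ht : t ∈ Icc (0 : ℝ) 1) : |(A.comp A').S r t| ≤ a * a' := by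
  have h := hA r.divNat _ (mapsTo_cellMap r.modNat ht)
  simp only [comp, Pi.mul_apply, Function.comp_apply, abs_mul]
  exact mul_le_mul h (hA' _ t ht) (abs_nonneg _) ((abs_nonneg _).trans h)

lemma finite_zeros_comp {A : SelfAffine F N} {A' : SelfAffine F M}
    (hA : ∀ i, {t ∈ Icc (0 : ℝ) 1 | A.S i t = 0}.Finite)
    (hA' : ∀ i, {t ∈ Icc (0 : ℝ) 1 | A'.S i t = 0}.Finite) (r : Fin (N * M)) :
    {t ∈ Icc (0 : ℝ) 1 | (A.comp A').S r t = 0}.Finite := by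
  refine (((hA r.divNat).preimage (cellMap_injective r.modNat).injOn).union
    (hA' r.modNat)).subset ?_
  rintro t ⟨ht, h0⟩
  rcases mul_eq_zero.1 h0 with h | h
  exacts [Or.inl ⟨mapsTo_cellMap _ ht, h⟩, Or.inr ⟨ht, h⟩]

lemma exists_iterate (A : SelfAffine F N) {s : ℝ} (hs : ∀ i, ∀ t ∈ Icc (0 : ℝ) 1, |A.S i t| ≤ s)
    (n : ℕ) : ∃ A' : SelfAffine F (N ^ n), (∀ i, ∀ t ∈ Icc (0 : ℝ) 1, |A'.S i t| ≤ s ^ n) ∧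
      ((∀ i, {t ∈ Icc (0 : ℝ) 1 | A.S i t = 0}.Finite) →
        ∀ i, {t ∈ Icc (0 : ℝ) 1 | A'.S i t = 0}.Finite) := by
  induction n with
  | zero => exact ⟨trivial A.continuousOn_F, by simp [trivial], by simp [trivial]⟩
  | succ n ih =>
    obtain ⟨A', hA', hzero⟩ := ih
    rw [pow_succ', pow_succ']
    exact ⟨A.comp A', fun r t ht => abs_comp_S_le hs hA' r ht,
      fun hz => finite_zeros_comp hz (hzero hz)⟩

lemma exists_abs_le (A : SelfAffine F N) : ∃ B, ∀ t ∈ Icc (0 : ℝ) 1, |F t| ≤ B :=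
  isCompact_Icc.exists_bound_of_continuousOn A.continuousOn_F

/-- The points of `[0, 1]` all of whose neighbourhoods carry infinite variation of `F`. -/
def singularSet (F : ℝ → ℝ) : Set ℝ :=
  {x ∈ Icc (0 : ℝ) 1 | ∀ U ∈ 𝓝[Icc 0 1] x, eVariationOn F U = ⊤}

-- Where `S i` is bounded away from `0`, the functional equation can be solved for `F`.
lemma eVariationOn_comp_cellMap_eq_top (A : SelfAffine F N) {i : Fin N} {x : ℝ}
    (hx : x ∈ singularSet F) (hS : A.S i x ≠ 0) {U : Set ℝ} (hU : U ∈ 𝓝[Icc 0 1] x) :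
    eVariationOn (F ∘ cellMap i) U = ⊤ := by
  by_contra hbv
  have hc : 0 < |A.S i x| / 2 := half_pos (abs_pos.2 hS)
  have hlow : ∀ᶠ t in 𝓝[Icc 0 1] x, |A.S i x| / 2 ≤ |A.S i t| :=
    (A.continuousOn_S i x hx.1).abs.eventually (le_mem_nhds (half_lt_self (abs_pos.2 hS)))
  obtain ⟨V, hV, hVU, hVI, hVS⟩ : ∃ V ∈ 𝓝[Icc 0 1] x, V ⊆ U ∧ V ⊆ Icc 0 1 ∧
      ∀ t ∈ V, |A.S i x| / 2 ≤ |A.S i t| :=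
    ⟨_, inter_mem (inter_mem hU self_mem_nhdsWithin) hlow, fun _ h => h.1.1, fun _ h => h.1.2,
      fun _ h => h.2⟩
  have hsolve : EqOn F ((A.S i)⁻¹ * (F ∘ cellMap i - A.q i)) V := fun t ht => by
    have h0 : A.S i t ≠ 0 := abs_pos.1 (hc.trans_le (hVS t ht))
    simp only [Pi.mul_apply, Pi.inv_apply, Pi.sub_apply, Function.comp_apply,
      A.map_eq i t (hVI ht), add_sub_cancel_right, inv_mul_cancel_left₀ h0]
  refine absurd (hx.2 V hV) (eVariationOn.congr hsolve ▸ ?_)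
  exact (boundedVariationOn_inv ((A.bv_S i).mono hVI) hc hVS).mul
    (boundedVariationOn_sub (BoundedVariationOn.mono hbv hVU) ((A.bv_q i).mono hVI))

lemma cellMap_mem_singularSet (A : SelfAffine F N) {i : Fin N} {x : ℝ}
    (hx : x ∈ singularSet F) (hS : A.S i x ≠ 0) : cellMap i x ∈ singularSet F := by
  refine ⟨mapsTo_cellMap i hx.1, fun U hU => ?_⟩
  have hpre : cellMap i ⁻¹' U ∈ 𝓝[Icc 0 1] x :=
    (continuous_cellMap i).continuousWithinAt.tendsto_nhdsWithin (mapsTo_cellMap i) hU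
  rw [← top_le_iff, ← A.eVariationOn_comp_cellMap_eq_top hx hS hpre]
  exact eVariationOn.comp_le_of_monotoneOn F _ ((monotone_cellMap i).monotoneOn _)
    (mapsTo_preimage _ _)

lemma sum_abs_S_le (A : SelfAffine F N) {s : ℝ} (hs : ∀ i, ∀ t ∈ Icc (0 : ℝ) 1, |A.S i t| ≤ s)
    (hfin : (singularSet F).Finite) {x : ℝ} (hx : x ∈ singularSet F) :
    ∑ i, |A.S i x| ≤ (singularSet F).ncard * s := by
  have hs0 : 0 ≤ s := (abs_nonneg _).trans (hs ⟨0, A.pos⟩ x hx.1)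
  have hinj : Function.Injective fun i : Fin N => cellMap i x := fun i j hij => by
    have hN : (N : ℝ) ≠ 0 := Nat.cast_ne_zero.2 A.pos.ne'
    simpa only [cellMap, div_left_inj' hN, add_left_inj, Nat.cast_inj, Fin.val_inj] using hij
  have hcard : (Finset.univ.filter fun i => A.S i x ≠ 0).card ≤ (singularSet F).ncard := by
    rw [← Set.ncard_coe_finset]
    exact ncard_le_ncard_of_injOn _ (fun i hi => A.cellMap_mem_singularSet hx (by simpa using hi))
      hinj.injOn hfin
  calc ∑ i, |A.S i x| = ∑ i with A.S i x ≠ 0, |A.S i x| :=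
        (Finset.sum_filter_of_ne fun i _ h => abs_ne_zero.1 h).symm
    _ ≤ (Finset.univ.filter fun i => A.S i x ≠ 0).card * s := by
        rw [← nsmul_eq_mul]
        exact Finset.sum_le_card_nsmul _ _ _ fun i _ => hs i x hx.1
    _ ≤ (singularSet F).ncard * s := by gcongr

/-- If `|F| ≤ B`, the bound for the error made in the total oscillation of `F` over any partition
of the `i`-th cell when `F ∘ cellMap i = S i * F + q i` is replaced by a multiple of `F`. -/
noncomputable def defect (A : SelfAffine F N) (B : ℝ) (i : Fin N) : ℝ :=
  B * (eVariationOn (A.S i) (Icc 0 1)).toReal + (eVariationOn (A.q i) (Icc 0 1)).toReal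

lemma defect_nonneg (A : SelfAffine F N) {B : ℝ} (hB : ∀ t ∈ Icc (0 : ℝ) 1, |F t| ≤ B)
    (i : Fin N) : 0 ≤ A.defect B i := by
  have hB0 : 0 ≤ B := (abs_nonneg _).trans (hB 0 (left_mem_Icc.2 zero_le_one))
  unfold defect
  positivity

lemma defect_comp_cellMap_le (A : SelfAffine F N) {B : ℝ} (hB : ∀ t ∈ Icc (0 : ℝ) 1, |F t| ≤ B)
    (i : Fin N) (c : Fin M) :
    B * (eVariationOn (A.S i ∘ cellMap c) (Icc 0 1)).toReal +
      (eVariationOn (A.q i ∘ cellMap c) (Icc 0 1)).toReal ≤ A.defect B i := by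
  have hB0 : 0 ≤ B := (abs_nonneg _).trans (hB 0 (left_mem_Icc.2 zero_le_one))
  exact add_le_add
    (mul_le_mul_of_nonneg_left (toReal_eVariationOn_comp_cellMap_le (A.bv_S i) c) hB0)
    (toReal_eVariationOn_comp_cellMap_le (A.bv_q i) c)

lemma oscSum_comp_cellMap_le (A : SelfAffine F N) {B σ : ℝ}
    (hB : ∀ t ∈ Icc (0 : ℝ) 1, |F t| ≤ B) {i : Fin N} {c : Fin M}
    (hσ : ∀ t ∈ cell c, |A.S i t| ≤ σ) (K : ℕ) :
    oscSum (F ∘ cellMap i ∘ cellMap c) K ≤ σ * oscSum (F ∘ cellMap c) K + A.defect B i :=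
  (oscSum_le_of_eq_mul_add (boundedVariationOn_comp_cellMap (A.bv_S i) c)
    (boundedVariationOn_comp_cellMap (A.bv_q i) c) (fun _ ht => hB _ (mapsTo_cellMap c ht))
    (fun _ ht => A.map_eq i _ (mapsTo_cellMap c ht)) (continuousOn_comp_cellMap A.continuousOn_F c)
    (fun _ ht => hσ _ (cellMap_mem_cell c ht)) K).trans
    (add_le_add_right (A.defect_comp_cellMap_le hB i c) _)

lemma le_oscSum_comp_cellMap (A : SelfAffine F N) {B σ : ℝ}
    (hB : ∀ t ∈ Icc (0 : ℝ) 1, |F t| ≤ B) {i : Fin N} {c : Fin M} (hσ0 : 0 ≤ σ)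
    (hσ : ∀ t ∈ cell c, σ ≤ |A.S i t|) (K : ℕ) :
    σ * oscSum (F ∘ cellMap c) K - A.defect B i ≤ oscSum (F ∘ cellMap i ∘ cellMap c) K :=
  (sub_le_sub_left (A.defect_comp_cellMap_le hB i c) _).trans <|
    le_oscSum_of_eq_mul_add (boundedVariationOn_comp_cellMap (A.bv_S i) c)
      (boundedVariationOn_comp_cellMap (A.bv_q i) c) (fun _ ht => hB _ (mapsTo_cellMap c ht))
      (fun _ ht => A.map_eq i _ (mapsTo_cellMap c ht))
      (continuousOn_comp_cellMap (continuousOn_comp_cellMap A.continuousOn_F i) c) hσ0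
      (fun _ ht => hσ _ (cellMap_mem_cell c ht)) K

lemma boundedVariationOn_comp_cellMap_cellMap (A : SelfAffine F N) {c : Fin M}
    (hF : BoundedVariationOn F (cell c)) (i : Fin N) :
    BoundedVariationOn (F ∘ cellMap i ∘ cellMap c) (Icc 0 1) := by
  have heq : EqOn (F ∘ cellMap i ∘ cellMap c)
      ((A.S i ∘ cellMap c) * (F ∘ cellMap c) + A.q i ∘ cellMap c) (Icc 0 1) :=
    fun t ht => A.map_eq i _ (mapsTo_cellMap c ht)
  have hFc : BoundedVariationOn (F ∘ cellMap c) (Icc 0 1) :=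
    (eVariationOn_comp_cellMap F c).trans_ne hF
  exact (eVariationOn.congr heq).trans_ne <| boundedVariationOn_add
    ((boundedVariationOn_comp_cellMap (A.bv_S i) c).mul hFc)
    (boundedVariationOn_comp_cellMap (A.bv_q i) c)

lemma exists_sum_oscSum_le (A : SelfAffine F N) {c : Fin M} {θ : ℝ} (hθ : 0 ≤ θ)
    (h : (∃ σ : Fin N → ℝ, ∑ i, σ i ≤ θ ∧ ∀ i, ∀ t ∈ cell c, |A.S i t| ≤ σ i) ∨
      BoundedVariationOn F (cell c)) :
    ∃ D, ∀ K, ∑ i : Fin N, oscSum (F ∘ cellMap i ∘ cellMap c) K ≤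
      θ * oscSum (F ∘ cellMap c) K + D := by
  rcases h with ⟨σ, hsum, hσ⟩ | hbv
  · obtain ⟨B, hB⟩ := A.exists_abs_le
    refine ⟨∑ i, A.defect B i, fun K => ?_⟩
    calc ∑ i : Fin N, oscSum (F ∘ cellMap i ∘ cellMap c) K
        ≤ ∑ i, (σ i * oscSum (F ∘ cellMap c) K + A.defect B i) :=
          Finset.sum_le_sum fun i _ => A.oscSum_comp_cellMap_le hB (hσ i) K
      _ ≤ θ * oscSum (F ∘ cellMap c) K + ∑ i, A.defect B i := by
          rw [Finset.sum_add_distrib, ← Finset.sum_mul]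
          exact add_le_add_left (mul_le_mul_of_nonneg_right hsum (oscSum_nonneg _ _)) _
  · refine ⟨∑ i : Fin N, (eVariationOn (F ∘ cellMap i ∘ cellMap c) (Icc 0 1)).toReal,
      fun K => ?_⟩
    refine le_trans ?_ (le_add_of_nonneg_left (mul_nonneg hθ (oscSum_nonneg _ _)))
    exact Finset.sum_le_sum fun i _ =>
      oscSum_le_eVariationOn (A.boundedVariationOn_comp_cellMap_cellMap hbv i) K

lemma exists_nhdsWithin_sum_abs_S_le (A : SelfAffine F N) {x θ : ℝ} (hx : x ∈ Icc (0 : ℝ) 1)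
    (hsum : ∑ i, |A.S i x| < θ) :
    ∃ U ∈ 𝓝[Icc 0 1] x, ∃ σ : Fin N → ℝ, ∑ i, σ i ≤ θ ∧ ∀ i, ∀ t ∈ U, |A.S i t| ≤ σ i := by
  have hN : (0 : ℝ) < N := Nat.cast_pos.2 A.pos
  let η : ℝ := (θ - ∑ i, |A.S i x|) / N
  have hη : 0 < η := div_pos (sub_pos.2 hsum) hN
  have hev : ∀ᶠ t in 𝓝[Icc 0 1] x, ∀ i, |A.S i t| ≤ |A.S i x| + η := eventually_all.2 fun i =>
    (A.continuousOn_S i x hx).abs.eventually (ge_mem_nhds (lt_add_of_pos_right _ hη))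
  refine ⟨_, hev, fun i => |A.S i x| + η, ?_, fun i t ht => ht i⟩
  rw [Finset.sum_add_distrib, Finset.sum_const, Finset.card_univ, Fintype.card_fin, nsmul_eq_mul,
    mul_div_cancel₀ _ hN.ne', add_sub_cancel]

lemma exists_oscSum_mul_le (A : SelfAffine F N) {θ : ℝ} (hθ : 0 ≤ θ)
    (h : ∀ x ∈ singularSet F, ∑ i, |A.S i x| < θ) :
    ∃ M > 0, ∃ D, ∀ K, oscSum F (N * (M * K)) ≤ θ * oscSum F (M * K) + D := by
  obtain ⟨M, hM, hcell⟩ := exists_forall_cell_of_nhdsWithin (P := fun U =>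
      (∃ σ : Fin N → ℝ, ∑ i, σ i ≤ θ ∧ ∀ i, ∀ t ∈ U, |A.S i t| ≤ σ i) ∨ BoundedVariationOn F U)
    (fun U V hUV hV => hV.imp (fun ⟨σ, hsum, hσ⟩ => ⟨σ, hsum, fun i t ht => hσ i t (hUV ht)⟩)
      fun hbv => hbv.mono hUV)
    fun x hx => by
      by_cases hxs : x ∈ singularSet F
      · obtain ⟨U, hU, hσ⟩ := A.exists_nhdsWithin_sum_abs_S_le hx (h x hxs)
        exact ⟨U, hU, Or.inl hσ⟩
      · have hreg : ∃ U ∈ 𝓝[Icc 0 1] x, eVariationOn F U ≠ ⊤ := by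
          simpa only [singularSet, mem_ofPred_eq, hx, true_and, not_forall, exists_prop] using hxs
        exact hreg.imp fun U hU => ⟨hU.1, Or.inr hU.2⟩
  choose D hD using fun c => A.exists_sum_oscSum_le hθ (hcell c)
  refine ⟨M, hM, ∑ c, D c, fun K => ?_⟩
  calc oscSum F (N * (M * K))
      = ∑ c : Fin M, ∑ i : Fin N, oscSum (F ∘ cellMap i ∘ cellMap c) K := by
        rw [oscSum_mul, Finset.sum_comm]
        exact Finset.sum_congr rfl fun i _ => oscSum_mul _ _ _
    _ ≤ ∑ c : Fin M, (θ * oscSum (F ∘ cellMap c) K + D c) := Finset.sum_le_sum fun c _ => hD c K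
    _ = θ * oscSum F (M * K) + ∑ c, D c := by
        rw [Finset.sum_add_distrib, ← Finset.mul_sum, ← oscSum_mul]

lemma boundedVariationOn_of_sum_abs_S_lt (A : SelfAffine F N) (hN : 1 < N) {θ : ℝ} (hθ0 : 0 ≤ θ)
    (hθ1 : θ < 1) (h : ∀ x ∈ singularSet F, ∑ i, |A.S i x| < θ) :
    BoundedVariationOn F (Icc 0 1) := by
  intro htop
  obtain ⟨M, hM, D, hD⟩ := A.exists_oscSum_mul_le hθ0 h
  let T := max (oscSum F M) (D / (1 - θ))
  have hbound (p : ℕ) : oscSum F (M * N ^ p) ≤ T := by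
    induction p with
    | zero => simpa only [pow_zero, mul_one] using le_max_left _ _
    | succ p ih =>
      have hDT : D ≤ T * (1 - θ) := (div_le_iff₀ (sub_pos.2 hθ1)).1 (le_max_right _ _)
      calc oscSum F (M * N ^ (p + 1)) = oscSum F (N * (M * N ^ p)) := by
            rw [pow_succ', mul_left_comm]
        _ ≤ θ * T + D := (hD _).trans (by gcongr)
        _ ≤ T := by linarith
  have hlim : Tendsto (fun p => oscSum F (M * N ^ p)) atTop atTop :=
    (tendsto_oscSum_atTop A.continuousOn_F htop).comp <|
      (tendsto_pow_atTop_atTop_of_one_lt hN).const_mul_atTop' hM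
  obtain ⟨p, hp⟩ := (hlim.eventually_gt_atTop T).exists
  exact hp.not_ge (hbound p)

lemma singularSet_infinite (A : SelfAffine F N) (hN : 1 < N) {s : ℝ} (hs1 : s < 1)
    (hs : ∀ i, ∀ t ∈ Icc (0 : ℝ) 1, |A.S i t| ≤ s) (h : eVariationOn F (Icc 0 1) = ⊤) :
    (singularSet F).Infinite := by
  intro hfin
  have hs0 : 0 ≤ s := (abs_nonneg _).trans (hs ⟨0, A.pos⟩ 0 (left_mem_Icc.2 zero_le_one))
  have hlim : Tendsto (fun n : ℕ => (singularSet F).ncard * s ^ n) atTop (𝓝 0) := by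
    simpa only [mul_zero] using (tendsto_pow_atTop_nhds_zero_of_lt_one hs0 hs1).const_mul _
  obtain ⟨n, hn, hn0⟩ := ((hlim.eventually (gt_mem_nhds one_half_pos)).and
    (eventually_ne_atTop 0)).exists
  obtain ⟨A', hA', -⟩ := A.exists_iterate hs n
  exact A'.boundedVariationOn_of_sum_abs_S_lt (Nat.one_lt_pow hn0 hN) one_half_pos.le
    one_half_lt_one (fun x hx => (A'.sum_abs_S_le hA' hfin hx).trans_lt hn) h

lemma eVariationOn_cell_eq_top (A : SelfAffine F N) (hN : 1 < N) {s : ℝ} (hs1 : s < 1)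
    (hs : ∀ i, ∀ t ∈ Icc (0 : ℝ) 1, |A.S i t| ≤ s)
    (hz : ∀ i, {t ∈ Icc (0 : ℝ) 1 | A.S i t = 0}.Finite)
    (h : eVariationOn F (Icc 0 1) = ⊤) {k : ℕ} (r : Fin (N ^ k)) :
    eVariationOn F (cell r) = ⊤ := by
  obtain ⟨A', -, hz'⟩ := A.exists_iterate hs k
  obtain ⟨x, hx, hx0⟩ := ((A.singularSet_infinite hN hs1 hs h).sdiff (hz' hz r)).nonempty
  rw [← eVariationOn_comp_cellMap]
  exact A'.eVariationOn_comp_cellMap_eq_top hx (fun h0 => hx0 ⟨hx.1, h0⟩) self_mem_nhdsWithin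

end SelfAffine

/-! ### The matrix recursion for oscillations -/

section Recursion

open Set Matrix

variable {F : ℝ → ℝ} {N k : ℕ}

/-- The vector whose entry at a cell `r` of level `k` is the sum of the oscillations of `F` over
the `N ^ p` equal parts of that cell. -/
noncomputable def cellOscSum (F : ℝ → ℝ) (N k p : ℕ) (r : Fin (N ^ k)) : ℝ :=
  oscSum (F ∘ cellMap r) (N ^ p)

lemma sum_cellOscSum (F : ℝ → ℝ) (N k p : ℕ) :
    ∑ r, cellOscSum F N k p r = oscSum F (N ^ (k + p)) := by
  rw [pow_add, oscSum_mul]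
  rfl

lemma cellOscSum_succ_prependDigit (F : ℝ → ℝ) (p : ℕ) (i : Fin N) (ℓ : Fin (N ^ k)) :
    cellOscSum F N (k + 1) (p + 1) (prependDigit (i, ℓ)) =
      ∑ d, oscSum (F ∘ cellMap i ∘ cellMap (appendDigit (ℓ, d))) (N ^ p) := by
  rw [cellOscSum, comp_cellMap_eq (pow_succ' N k) (prependDigit_val i ℓ), pow_succ', oscSum_mul]
  exact Finset.sum_congr rfl fun d _ => congrArg (oscSum · _)
    (comp_cellMap_eq (pow_succ N k) (appendDigit_val ℓ d) (F ∘ cellMap i)).symm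

namespace SelfAffine

variable {s : Fin N → Fin (N ^ (k + 1)) → ℝ} {θ : ℝ}

lemma exists_cellOscSum_succ_le (A : SelfAffine F N)
    (hs : ∀ i j, ∀ t ∈ cell j, |A.S i t| ≤ s i j) :
    ∃ c, ∀ p r, cellOscSum F N (k + 1) (p + 1) r ≤
      (scalingMatrix N k s *ᵥ cellOscSum F N (k + 1) p) r + c := by
  obtain ⟨B, hB⟩ := A.exists_abs_le
  refine ⟨N * ∑ i, A.defect B i, fun p r => ?_⟩
  obtain ⟨⟨i, ℓ⟩, rfl⟩ := prependDigit.surjective r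
  rw [cellOscSum_succ_prependDigit, scalingMatrix_mulVec_prependDigit]
  calc ∑ d, oscSum (F ∘ cellMap i ∘ cellMap (appendDigit (ℓ, d))) (N ^ p)
      ≤ ∑ d, (s i (appendDigit (ℓ, d)) * cellOscSum F N (k + 1) p (appendDigit (ℓ, d)) +
          ∑ i, A.defect B i) := Finset.sum_le_sum fun d _ =>
        (A.oscSum_comp_cellMap_le hB (hs i _) _).trans <| add_le_add_right
          (Finset.single_le_sum (fun i _ => A.defect_nonneg hB i) (Finset.mem_univ i)) _
    _ = _ := by
      rw [Finset.sum_add_distrib, Finset.sum_const, Finset.card_univ, Fintype.card_fin,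
        nsmul_eq_mul]

lemma exists_le_cellOscSum_succ (A : SelfAffine F N) (hs0 : ∀ i j, 0 ≤ s i j)
    (hs : ∀ i j, ∀ t ∈ cell j, s i j ≤ |A.S i t|) :
    ∃ c, ∀ p r, (scalingMatrix N k s *ᵥ cellOscSum F N (k + 1) p) r - c ≤
      cellOscSum F N (k + 1) (p + 1) r := by
  obtain ⟨B, hB⟩ := A.exists_abs_le
  refine ⟨N * ∑ i, A.defect B i, fun p r => ?_⟩
  obtain ⟨⟨i, ℓ⟩, rfl⟩ := prependDigit.surjective r
  rw [cellOscSum_succ_prependDigit, scalingMatrix_mulVec_prependDigit]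
  calc (∑ d, s i (appendDigit (ℓ, d)) * cellOscSum F N (k + 1) p (appendDigit (ℓ, d))) -
        N * ∑ i, A.defect B i
      = ∑ d, (s i (appendDigit (ℓ, d)) * cellOscSum F N (k + 1) p (appendDigit (ℓ, d)) -
          ∑ i, A.defect B i) := by
        rw [Finset.sum_sub_distrib, Finset.sum_const, Finset.card_univ, Fintype.card_fin,
          nsmul_eq_mul]
    _ ≤ ∑ d, oscSum (F ∘ cellMap i ∘ cellMap (appendDigit (ℓ, d))) (N ^ p) :=
      Finset.sum_le_sum fun d _ => (sub_le_sub_left (Finset.single_le_sum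
        (fun i _ => A.defect_nonneg hB i) (Finset.mem_univ i)) _).trans
          (A.le_oscSum_comp_cellMap hB (hs0 i _) (hs i _) _)

lemma exists_oscSum_pow_le (A : SelfAffine F N) (hs0 : ∀ i j, 0 ≤ s i j)
    (hs : ∀ i j, ∀ t ∈ cell j, |A.S i t| ≤ s i j) (hθ1 : 1 ≤ θ)
    (hθ : matrixSpectralRadius (scalingMatrix N k s) < θ) :
    ∃ C, ∀ᶠ m in atTop, oscSum F (N ^ m) ≤ C * θ ^ m := by
  obtain ⟨c, hc⟩ := A.exists_cellOscSum_succ_le hs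
  obtain ⟨C, hC0, hC⟩ := exists_le_mul_pow_of_le_mulVec_add (scalingMatrix_nonneg hs0) hc hθ1 hθ
  refine ⟨(N ^ (k + 1) : ℕ) * C, ?_⟩
  filter_upwards [eventually_ge_atTop (k + 1)] with m hm
  obtain ⟨p, rfl⟩ := Nat.exists_eq_add_of_le hm
  calc oscSum F (N ^ (k + 1 + p)) = ∑ r, cellOscSum F N (k + 1) p r := (sum_cellOscSum ..).symm
    _ ≤ ∑ _r : Fin (N ^ (k + 1)), C * θ ^ p := Finset.sum_le_sum fun r _ => hC p r
    _ = (N ^ (k + 1) : ℕ) * C * θ ^ p := by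
        rw [Finset.sum_const, Finset.card_univ, Fintype.card_fin, nsmul_eq_mul, mul_assoc]
    _ ≤ (N ^ (k + 1) : ℕ) * C * θ ^ (k + 1 + p) := by
        gcongr
        exact Nat.le_add_left _ _

lemma exists_le_oscSum_pow (A : SelfAffine F N) (hN : 1 < N) (hs0 : ∀ i j, 0 ≤ s i j)
    (hs : ∀ i j, ∀ t ∈ cell j, s i j ≤ |A.S i t|)
    (htop : ∀ r : Fin (N ^ (k + 1)), eVariationOn F (cell r) = ⊤) (hθ1 : 1 ≤ θ)
    (hθ : θ < matrixSpectralRadius (scalingMatrix N k s)) :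
    ∃ C, 0 < C ∧ ∀ᶠ m in atTop, C * θ ^ m ≤ oscSum F (N ^ m) := by
  have : NeZero N := ⟨A.pos.ne'⟩
  obtain ⟨c, hc⟩ := A.exists_le_cellOscSum_succ hs0 hs
  have hlarge (T : ℝ) : ∃ p, ∀ r, T ≤ cellOscSum F N (k + 1) p r :=
    (eventually_all.2 fun r => ((tendsto_oscSum_atTop (continuousOn_comp_cellMap A.continuousOn_F r)
      ((eVariationOn_comp_cellMap F r).trans (htop r))).comp
        (tendsto_pow_atTop_atTop_of_one_lt hN)).eventually_ge_atTop T).exists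
  obtain ⟨C, hC0, p₀, r, hC⟩ := exists_mul_pow_le_of_mulVec_sub_le (scalingMatrix_nonneg hs0)
    (fun p r => oscSum_nonneg _ _) hc hlarge hθ1 hθ
  have : 0 < θ := one_pos.trans_le hθ1
  refine ⟨C / θ ^ (k + 1 + p₀), by positivity, ?_⟩
  filter_upwards [eventually_ge_atTop (k + 1 + p₀)] with m hm
  obtain ⟨p, rfl⟩ := Nat.exists_eq_add_of_le hm
  calc C / θ ^ (k + 1 + p₀) * θ ^ (k + 1 + p₀ + p) = C * θ ^ p := by
        rw [pow_add θ (k + 1 + p₀), ← mul_assoc, div_mul_cancel₀ _ (by positivity)]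
    _ ≤ cellOscSum F N (k + 1) (p₀ + p) r := hC p
    _ ≤ ∑ r, cellOscSum F N (k + 1) (p₀ + p) r :=
        Finset.single_le_sum (f := cellOscSum F N (k + 1) (p₀ + p)) (fun r _ => oscSum_nonneg _ _)
          (Finset.mem_univ r)
    _ = oscSum F (N ^ (k + 1 + p₀ + p)) := by rw [sum_cellOscSum, add_assoc (k + 1)]

end SelfAffine

end Recursion

/-! ### Counting coordinate squares -/

section BoxCount

open Set

variable {E : Set (ℝ × ℝ)} {ε : ℝ}

lemma card_Icc_ceil_floor_le {a b : ℝ} (hab : a ≤ b) :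
    ((Finset.Icc ⌈a⌉ ⌊b⌋).card : ℝ) ≤ b - a + 1 := by
  have hle : ⌈a⌉ ≤ ⌊b⌋ + 1 :=
    Int.ceil_le.2 (by exact_mod_cast hab.trans (Int.lt_floor_add_one b).le)
  have hcard : ((Finset.Icc ⌈a⌉ ⌊b⌋).card : ℝ) = ⌊b⌋ + 1 - ⌈a⌉ := by
    exact_mod_cast Int.card_Icc_of_le _ _ hle
  linarith [Int.floor_le b, Int.le_ceil a]

lemma exists_mem_coordSquare (hε : 0 < ε) (p : ℝ × ℝ) : ∃ k, p ∈ coordSquare ε k :=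
  ⟨(⌊p.1 / ε⌋, ⌊p.2 / ε⌋), ⟨(le_div_iff₀ hε).1 (Int.floor_le _),
    (div_le_iff₀ hε).1 (Int.lt_floor_add_one _).le⟩, (le_div_iff₀ hε).1 (Int.floor_le _),
    (div_le_iff₀ hε).1 (Int.lt_floor_add_one _).le⟩

lemma meeting_squares_subset {p q : ℝ × ℝ} (hε : 0 < ε) (hE : E ⊆ Icc p q) :
    {k : ℤ × ℤ | (coordSquare ε k ∩ E).Nonempty} ⊆
      ↑(Finset.Icc ⌈p.1 / ε - 1⌉ ⌊q.1 / ε⌋ ×ˢ Finset.Icc ⌈p.2 / ε - 1⌉ ⌊q.2 / ε⌋) := by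
  rintro k ⟨z, ⟨hz1, hz2⟩, hzE⟩
  obtain ⟨⟨hp1, hp2⟩, hq1, hq2⟩ := hE hzE
  simp only [Finset.coe_product, Finset.coe_Icc, mem_prod, mem_Icc, Int.ceil_le, Int.le_floor,
    sub_le_iff_le_add, div_le_iff₀ hε, le_div_iff₀ hε]
  exact ⟨⟨hp1.trans hz1.2, hz1.1.trans hq1⟩, hp2.trans hz2.2, hz2.1.trans hq2⟩

lemma finite_meeting_squares (hε : 0 < ε) (hE : Bornology.IsBounded E) :
    {k : ℤ × ℤ | (coordSquare ε k ∩ E).Nonempty}.Finite := by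
  obtain ⟨⟨p, hp⟩, q, hq⟩ := isBounded_iff_bddBelow_bddAbove.1 hE
  exact (Finset.finite_toSet _).subset
    (meeting_squares_subset hε fun z hz => ⟨hp hz, hq hz⟩)

lemma boxCount_le_of_subset_Icc {p q : ℝ × ℝ} (hε : 0 < ε) (hpq : p ≤ q) (hE : E ⊆ Icc p q) :
    (boxCount E ε : ℝ) ≤ ((q.1 - p.1) / ε + 2) * ((q.2 - p.2) / ε + 2) := by
  have hside {a b : ℝ} (hab : a ≤ b) :
      ((Finset.Icc ⌈a / ε - 1⌉ ⌊b / ε⌋).card : ℝ) ≤ (b - a) / ε + 2 := by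
    refine (card_Icc_ceil_floor_le ((sub_le_self _ zero_le_one).trans ?_)).trans_eq ?_
    · gcongr
    · ring
  have hcard := ncard_le_ncard (meeting_squares_subset hε hE) (Finset.finite_toSet _)
  rw [ncard_coe_finset, Finset.card_product] at hcard
  calc (boxCount E ε : ℝ) ≤ (Finset.Icc ⌈p.1 / ε - 1⌉ ⌊q.1 / ε⌋).card *
        (Finset.Icc ⌈p.2 / ε - 1⌉ ⌊q.2 / ε⌋).card := by exact_mod_cast hcard
    _ ≤ ((q.1 - p.1) / ε + 2) * ((q.2 - p.2) / ε + 2) :=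
        mul_le_mul (hside hpq.1) (hside hpq.2) (Nat.cast_nonneg _)
          ((Nat.cast_nonneg _).trans (hside hpq.1))

lemma boxCount_iUnion_le {ι : Type*} [Fintype ι] (E : ι → Set (ℝ × ℝ)) (ε : ℝ) :
    boxCount (⋃ c, E c) ε ≤ ∑ c, boxCount (E c) ε := by
  simp only [boxCount, inter_iUnion, nonempty_iUnion, ofPred_exists]
  exact ncard_iUnion_le_of_fintype _

open scoped Classical in
lemma sum_boxCount_le {ι : Type*} [Fintype ι] {E : ι → Set (ℝ × ℝ)} {n : ℕ} (hε : 0 < ε)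
    (hE : Bornology.IsBounded (⋃ c, E c))
    (hn : ∀ k, (Finset.univ.filter fun c => (coordSquare ε k ∩ E c).Nonempty).card ≤ n) :
    ∑ c, boxCount (E c) ε ≤ n * boxCount (⋃ c, E c) ε := by
  have hfin := finite_meeting_squares hε hE
  have hcount (c : ι) : boxCount (E c) ε =
      (hfin.toFinset.filter fun k => (coordSquare ε k ∩ E c).Nonempty).card := by
    rw [boxCount, ← ncard_coe_finset]
    congr 1
    ext k
    simp only [Finset.coe_filter, Finite.mem_toFinset, mem_ofPred_eq, iff_and_self]
    exact fun h => h.mono (inter_subset_inter_right _ (subset_iUnion E c))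
  calc ∑ c, boxCount (E c) ε
      = ∑ k ∈ hfin.toFinset,
          (Finset.univ.filter fun c => (coordSquare ε k ∩ E c).Nonempty).card := by
        simp only [hcount]
        exact Finset.sum_card_bipartiteAbove_eq_sum_card_bipartiteBelow _
    _ ≤ ∑ _k ∈ hfin.toFinset, n := Finset.sum_le_sum fun k _ => hn k
    _ = n * boxCount (⋃ c, E c) ε := by
        rw [Finset.sum_const, smul_eq_mul, mul_comm, boxCount, ncard_eq_toFinset_card _ hfin]

lemma one_le_boxCount (hε : 0 < ε) (hb : Bornology.IsBounded E) (hE : E.Nonempty) :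
    1 ≤ boxCount E ε := by
  obtain ⟨p, hp⟩ := hE
  obtain ⟨k, hk⟩ := exists_mem_coordSquare hε p
  exact (ncard_pos (finite_meeting_squares hε hb)).2 ⟨k, p, hk, hp⟩

-- The heights of the squares that meet `E` cover the interval between the heights of `p` and `q`.
lemma snd_sub_snd_le_boxCount (hε : 0 < ε) (hb : Bornology.IsBounded E) (hE : IsPreconnected E)
    {p q : ℝ × ℝ} (hp : p ∈ E) (hq : q ∈ E) : q.2 - p.2 ≤ boxCount E ε * ε := by
  have hfin := finite_meeting_squares hε hb
  have hcover : Icc p.2 q.2 ⊆ ⋃ k ∈ hfin.toFinset, Icc (k.2 * ε) ((k.2 + 1) * ε) := fun y hy => by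
    obtain ⟨z, hz, rfl⟩ := (hE.image Prod.snd continuous_snd.continuousOn).Icc_subset
      (mem_image_of_mem _ hp) (mem_image_of_mem _ hq) hy
    obtain ⟨k, hk⟩ := exists_mem_coordSquare hε z
    exact mem_iUnion₂.2 ⟨k, hfin.mem_toFinset.2 ⟨z, hk, hz⟩, hk.2⟩
  have hvol := (MeasureTheory.measure_mono (μ := MeasureTheory.volume) hcover).trans
    (MeasureTheory.measure_biUnion_finset_le _ _)
  have hlen (k : ℤ × ℤ) : (k.2 + 1) * ε - k.2 * ε = ε := by ring
  simp only [Real.volume_Icc, hlen, Finset.sum_const, ← ncard_eq_toFinset_card _ hfin,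
    nsmul_eq_mul] at hvol
  rw [← ENNReal.ofReal_natCast, ← ENNReal.ofReal_mul (Nat.cast_nonneg _)] at hvol
  exact (ENNReal.ofReal_le_ofReal_iff (by positivity)).1 hvol

end BoxCount

/-! ### Box counts and oscillations -/

section ScaledGraph

open Set

variable {F : ℝ → ℝ} {x₀ D ε : ℝ} {M : ℕ} {s : Set ℝ}

/-- The graph of `F` over `s`, with the base changed by `t ↦ x₀ + D * t`: the graph of a fractal
interpolation function on `[x₀, x₀ + D]` in terms of its rescaling to `[0, 1]`. -/
def scaledGraph (x₀ D : ℝ) (F : ℝ → ℝ) (s : Set ℝ) : Set (ℝ × ℝ) :=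
  (fun t => (x₀ + D * t, F t)) '' s

lemma continuousOn_scaledGraph (hF : ContinuousOn F s) :
    ContinuousOn (fun t => (x₀ + D * t, F t)) s :=
  (by fun_prop : Continuous fun t => x₀ + D * t).continuousOn.prodMk hF

lemma isBounded_scaledGraph (hF : ContinuousOn F (Icc 0 1)) (hs : s ⊆ Icc 0 1) :
    Bornology.IsBounded (scaledGraph x₀ D F s) :=
  (isCompact_Icc.image_of_continuousOn (continuousOn_scaledGraph hF)).isBounded.subset
    (image_mono hs)

lemma iUnion_scaledGraph_cell (hM : 0 < M) :
    ⋃ c : Fin M, scaledGraph x₀ D F (cell c) = scaledGraph x₀ D F (Icc 0 1) := by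
  have hcell : ⋃ c : Fin M, cell c = Icc 0 1 :=
    Subset.antisymm (iUnion_subset cell_subset_Icc) fun t ht => mem_iUnion.2 (exists_mem_cell hM ht)
  rw [← hcell, scaledGraph, image_iUnion]
  rfl

lemma boxCount_scaledGraph_cell_le (hF : ContinuousOn F (Icc 0 1)) (hD : 0 ≤ D) (hε : 0 < ε)
    (hMε : D / M ≤ ε) (c : Fin M) :
    (boxCount (scaledGraph x₀ D F (cell c)) ε : ℝ) ≤ 6 * (osc F c / ε) + 6 := by
  have hosc : 0 ≤ osc F c := Metric.diam_nonneg
  have hsub : scaledGraph x₀ D F (cell c) ⊆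
      Icc (x₀ + D * (c / M), F (c / M) - osc F c)
        (x₀ + D * ((c + 1) / M), F (c / M) + osc F c) := by
    rintro _ ⟨t, ht, rfl⟩
    have hab := abs_le.1 (abs_sub_le_osc (isBounded_image_of_continuousOn hF) ht (left_mem_cell c))
    refine ⟨⟨?_, by linarith [hab.1]⟩, ?_, by linarith [hab.2]⟩
    · exact add_le_add_right (mul_le_mul_of_nonneg_left ht.1 hD) _
    · exact add_le_add_right (mul_le_mul_of_nonneg_left ht.2 hD) _
  have hle : (x₀ + D * (c / M), F (c / M) - osc F c) ≤
      (x₀ + D * ((c + 1) / M), F (c / M) + osc F c) := by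
    refine ⟨add_le_add_right (mul_le_mul_of_nonneg_left ?_ hD) _, by dsimp only; linarith⟩
    exact (left_mem_cell c).2
  have hwidth : (x₀ + D * ((c + 1) / M) - (x₀ + D * (c / M))) / ε ≤ 1 := by
    rw [div_le_one hε]
    exact (by ring : _ = D / M).trans_le hMε
  calc (boxCount (scaledGraph x₀ D F (cell c)) ε : ℝ)
      ≤ (1 + 2) * ((F (c / M) + osc F c - (F (c / M) - osc F c)) / ε + 2) :=
        (boxCount_le_of_subset_Icc hε hle hsub).trans <| mul_le_mul_of_nonneg_right
          (add_le_add_left hwidth 2) (by ring_nf; positivity)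
    _ = 6 * (osc F c / ε) + 6 := by ring

lemma boxCount_scaledGraph_le (hF : ContinuousOn F (Icc 0 1)) (hD : 0 ≤ D) (hM : 0 < M)
    (hε : 0 < ε) (hMε : D / M ≤ ε) :
    (boxCount (scaledGraph x₀ D F (Icc 0 1)) ε : ℝ) ≤ 6 * (oscSum F M / ε + M) := by
  rw [← iUnion_scaledGraph_cell hM]
  calc (boxCount (⋃ c : Fin M, scaledGraph x₀ D F (cell c)) ε : ℝ)
      ≤ ∑ c : Fin M, (boxCount (scaledGraph x₀ D F (cell c)) ε : ℝ) := by
        exact_mod_cast boxCount_iUnion_le _ ε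
    _ ≤ ∑ c : Fin M, (6 * (osc F c / ε) + 6) :=
        Finset.sum_le_sum fun c _ => boxCount_scaledGraph_cell_le hF hD hε hMε c
    _ = 6 * (oscSum F M / ε + M) := by
        rw [Finset.sum_add_distrib, ← Finset.mul_sum, ← Finset.sum_div, Finset.sum_const,
          Finset.card_univ, Fintype.card_fin, nsmul_eq_mul, oscSum]
        ring

open scoped Classical in
lemma card_cells_le_three (hD : 0 < D) (hε : 0 < ε) (hMε : ε ≤ D / M) (k : ℤ × ℤ) :
    (Finset.univ.filter fun c : Fin M =>
      (coordSquare ε k ∩ scaledGraph x₀ D F (cell c)).Nonempty).card ≤ 3 := by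
  have hDM : 0 < D / M := hε.trans_le hMε
  let α : ℝ := (k.1 * ε - x₀) / (D / M)
  have hmem : ∀ c : Fin M, (coordSquare ε k ∩ scaledGraph x₀ D F (cell c)).Nonempty →
      ((c : ℕ) : ℤ) ∈ Finset.Icc ⌈α - 1⌉ ⌊α + 1⌋ := by
    rintro c ⟨_, ⟨⟨hk1, hk2⟩, -⟩, t, ht, rfl⟩
    have hlow := mul_le_mul_of_nonneg_left ht.1 hD.le
    have hhigh := mul_le_mul_of_nonneg_left ht.2 hD.le
    have hdiv : D / M * α = k.1 * ε - x₀ := mul_div_cancel₀ _ hDM.ne'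
    have hstep (y : ℝ) : D * (y / M) = D / M * y := by ring
    rw [hstep] at hlow hhigh
    rw [Finset.mem_Icc, Int.ceil_le, Int.le_floor, Int.cast_natCast]
    constructor <;> refine le_of_mul_le_mul_left ?_ hDM <;> simp only at hk1 hk2 <;> linarith
  have hcard := Finset.card_le_card_of_injOn (fun c : Fin M => ((c : ℕ) : ℤ))
    (s := Finset.univ.filter fun c => (coordSquare ε k ∩ scaledGraph x₀ D F (cell c)).Nonempty)
    (fun c hc => hmem c (Finset.mem_filter.1 hc).2)
    (Nat.cast_injective.comp Fin.val_injective).injOn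
  have hthree := card_Icc_ceil_floor_le (show α - 1 ≤ α + 1 by linarith)
  rw [show α + 1 - (α - 1) + 1 = (3 : ℕ) by push_cast; ring] at hthree
  exact hcard.trans (by exact_mod_cast hthree)

lemma sum_boxCount_scaledGraph_cell_le (hF : ContinuousOn F (Icc 0 1)) (hD : 0 < D) (hM : 0 < M)
    (hε : 0 < ε) (hMε : ε ≤ D / M) :
    ∑ c : Fin M, (boxCount (scaledGraph x₀ D F (cell c)) ε : ℝ) ≤
      3 * boxCount (scaledGraph x₀ D F (Icc 0 1)) ε := by
  rw [← iUnion_scaledGraph_cell hM]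
  exact_mod_cast sum_boxCount_le hε
    ((iUnion_scaledGraph_cell hM).symm ▸ isBounded_scaledGraph hF Subset.rfl)
    (card_cells_le_three hD hε hMε)

lemma natCast_le_boxCount (hF : ContinuousOn F (Icc 0 1)) (hD : 0 < D) (hM : 0 < M)
    (hε : 0 < ε) (hMε : ε ≤ D / M) :
    (M : ℝ) ≤ 3 * boxCount (scaledGraph x₀ D F (Icc 0 1)) ε := by
  refine le_trans ?_ (sum_boxCount_scaledGraph_cell_le hF hD hM hε hMε)
  calc (M : ℝ) = ∑ _c : Fin M, (1 : ℝ) := by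
        rw [Finset.sum_const, Finset.card_univ, Fintype.card_fin, nsmul_one]
    _ ≤ _ := Finset.sum_le_sum fun c _ => by
        exact_mod_cast one_le_boxCount hε (isBounded_scaledGraph hF (cell_subset_Icc c))
          ⟨_, mem_image_of_mem _ (left_mem_cell c)⟩

lemma osc_le_boxCount_mul (hF : ContinuousOn F (Icc 0 1)) (hε : 0 < ε) (c : Fin M) :
    osc F c ≤ boxCount (scaledGraph x₀ D F (cell c)) ε * ε := by
  have hconn : IsPreconnected (scaledGraph x₀ D F (cell c)) :=
    isPreconnected_Icc.image _ (continuousOn_scaledGraph (hF.mono (cell_subset_Icc c)))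
  have hb : Bornology.IsBounded (scaledGraph x₀ D F (cell c)) :=
    isBounded_scaledGraph hF (cell_subset_Icc c)
  refine osc_le (by positivity) fun u hu v hv => abs_sub_le_iff.2 ⟨?_, ?_⟩
  · exact snd_sub_snd_le_boxCount hε hb hconn (mem_image_of_mem _ hv) (mem_image_of_mem _ hu)
  · exact snd_sub_snd_le_boxCount hε hb hconn (mem_image_of_mem _ hu) (mem_image_of_mem _ hv)

lemma oscSum_div_le_boxCount (hF : ContinuousOn F (Icc 0 1)) (hD : 0 < D) (hM : 0 < M)
    (hε : 0 < ε) (hMε : ε ≤ D / M) :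
    oscSum F M / ε ≤ 3 * boxCount (scaledGraph x₀ D F (Icc 0 1)) ε := by
  refine le_trans ?_ (sum_boxCount_scaledGraph_cell_le hF hD hM hε hMε)
  rw [oscSum, Finset.sum_div]
  exact Finset.sum_le_sum fun c _ => (div_le_iff₀ hε).2 (osc_le_boxCount_mul hF hε c)

end ScaledGraph

/-! ### Box dimension from counts at the scales `N⁻ᵐ` -/

section Dimension

open Set

variable {E : Set (ℝ × ℝ)} {F : ℝ → ℝ} {N : ℕ} {x₀ D C η θ : ℝ}

lemma tendsto_const_add_div_log (β K : ℝ) :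
    Tendsto (fun ε : ℝ => ((β + K / Real.log (1 / ε) : ℝ) : EReal)) (𝓝[>] 0) (𝓝 (β : EReal)) := by
  have hlog : Tendsto (fun ε : ℝ => Real.log (1 / ε)) (𝓝[>] 0) atTop := by
    simp only [one_div]
    exact Real.tendsto_log_atTop.comp tendsto_inv_nhdsGT_zero
  have hsum := (tendsto_const_nhds (x := β)).add ((tendsto_const_nhds (x := K)).div_atTop hlog)
  rw [add_zero] at hsum
  exact (continuous_coe_real_ereal.tendsto β).comp hsum

lemma eventually_log_one_div_pos : ∀ᶠ ε : ℝ in 𝓝[>] 0, 0 < Real.log (1 / ε) := by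
  filter_upwards [Ioo_mem_nhdsGT (zero_lt_one' ℝ)] with ε hε
  exact Real.log_pos (one_lt_one_div hε.1 hε.2)

lemma upperBoxDim_le_of_log_le {β K : ℝ}
    (h : ∀ᶠ ε : ℝ in 𝓝[>] 0, Real.log (boxCount E ε) ≤ β * Real.log (1 / ε) + K) :
    upperBoxDim E ≤ (β : EReal) := by
  rw [← (tendsto_const_add_div_log β K).limsup_eq]
  refine limsup_le_limsup ?_
  filter_upwards [h, eventually_log_one_div_pos] with ε hle hpos
  rwa [EReal.coe_le_coe_iff, div_le_iff₀ hpos, add_mul, div_mul_cancel₀ _ hpos.ne']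

lemma le_lowerBoxDim_of_le_log {β K : ℝ}
    (h : ∀ᶠ ε : ℝ in 𝓝[>] 0, β * Real.log (1 / ε) + K ≤ Real.log (boxCount E ε)) :
    (β : EReal) ≤ lowerBoxDim E := by
  rw [← (tendsto_const_add_div_log β K).liminf_eq]
  refine liminf_le_liminf ?_
  filter_upwards [h, eventually_log_one_div_pos] with ε hle hpos
  rwa [EReal.coe_le_coe_iff, le_div_iff₀ hpos, add_mul, div_mul_cancel₀ _ hpos.ne']

lemma lowerBoxDim_le_upperBoxDim (E : Set (ℝ × ℝ)) : lowerBoxDim E ≤ upperBoxDim E :=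
  liminf_le_limsup

lemma hasBoxDim_of_le {d : ℝ} (hle : (d : EReal) ≤ lowerBoxDim E) (hge : upperBoxDim E ≤ d) :
    HasBoxDim E d :=
  ⟨le_antisymm ((lowerBoxDim_le_upperBoxDim E).trans hge) hle,
    le_antisymm hge (hle.trans (lowerBoxDim_le_upperBoxDim E))⟩

lemma eventually_exists_pow_near (hN : 1 < N) (hD : 0 < D) {p : ℕ → Prop}
    (hp : ∀ᶠ m in atTop, p m) :
    ∀ᶠ ε : ℝ in 𝓝[>] 0, 0 < ε ∧
      ∃ m, p m ∧ (N : ℝ) ^ m ≤ D / ε ∧ D / ε < (N : ℝ) ^ (m + 1) := by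
  have hN1 : (1 : ℝ) < N := by exact_mod_cast hN
  obtain ⟨m₀, hm₀⟩ := eventually_atTop.1 hp
  filter_upwards [Ioo_mem_nhdsGT (by positivity : 0 < D / (N : ℝ) ^ m₀)] with ε ⟨hε, hεD⟩
  have hlt : (N : ℝ) ^ m₀ < D / ε := (lt_div_comm₀ hε (by positivity)).1 hεD
  obtain ⟨m, hle, hgt⟩ := exists_nat_pow_near ((one_le_pow₀ hN1.le).trans hlt.le) hN1
  have hm : m₀ < m + 1 := (pow_lt_pow_iff_right₀ hN1).1 (hlt.trans hgt)
  exact ⟨hε, m, hm₀ m (Nat.lt_succ_iff.1 hm), hle, hgt⟩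

lemma log_div_eq_log_add_log_one_div {ε : ℝ} (hD : 0 < D) (hε : 0 < ε) :
    Real.log (D / ε) = Real.log D + Real.log (1 / ε) := by
  rw [div_eq_mul_one_div, Real.log_mul hD.ne' (by positivity)]

lemma upperBoxDim_le_of_boxCount_le (hN : 1 < N) (hD : 0 < D) (hη : 1 ≤ η)
    (h : ∀ᶠ m in atTop, ∀ ε > 0, (N : ℝ) ^ m ≤ D / ε → D / ε < (N : ℝ) ^ (m + 1) →
      (boxCount E ε : ℝ) ≤ C * η ^ m) :
    upperBoxDim E ≤ ((Real.log η / Real.log N : ℝ) : EReal) := by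
  have hlogN : 0 < Real.log N := Real.log_pos (by exact_mod_cast hN)
  have hlogη : 0 ≤ Real.log η := Real.log_nonneg hη
  refine upperBoxDim_le_of_log_le
    (K := Real.log η / Real.log N * Real.log D + Real.log (max C 1)) ?_
  filter_upwards [eventually_exists_pow_near hN hD h] with ε ⟨hε, m, hcount, hle, hgt⟩
  have hm : m * Real.log N ≤ Real.log D + Real.log (1 / ε) := by
    rw [← log_div_eq_log_add_log_one_div hD hε, ← Real.log_pow]
    exact Real.log_le_log (by positivity) hle
  have hbound : (boxCount E ε : ℝ) ≤ max C 1 * η ^ m :=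
    (hcount ε hε hle hgt).trans (by gcongr; exact le_max_left _ _)
  have hlog : Real.log (boxCount E ε) ≤ Real.log (max C 1) + m * Real.log η := by
    rcases (boxCount E ε).eq_zero_or_pos with h0 | hpos
    · rw [h0, Nat.cast_zero, Real.log_zero]
      exact add_nonneg (Real.log_nonneg (le_max_right _ _)) (by positivity)
    · rw [← Real.log_pow, ← Real.log_mul (by positivity) (by positivity)]
      exact Real.log_le_log (by exact_mod_cast hpos) hbound
  have hslope : m * Real.log η ≤
      Real.log η / Real.log N * (Real.log D + Real.log (1 / ε)) :=
    calc m * Real.log η = Real.log η / Real.log N * (m * Real.log N) := by field_simp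
      _ ≤ _ := by gcongr
  linarith

lemma le_lowerBoxDim_of_le_boxCount (hN : 1 < N) (hD : 0 < D) (hη : 1 ≤ η) (hC : 0 < C)
    (h : ∀ᶠ m in atTop, ∀ ε > 0, (N : ℝ) ^ m ≤ D / ε → D / ε < (N : ℝ) ^ (m + 1) →
      C * η ^ m ≤ (boxCount E ε : ℝ)) :
    ((Real.log η / Real.log N : ℝ) : EReal) ≤ lowerBoxDim E := by
  have hlogN : 0 < Real.log N := Real.log_pos (by exact_mod_cast hN)
  have hlogη : 0 ≤ Real.log η := Real.log_nonneg hη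
  refine le_lowerBoxDim_of_le_log
    (K := Real.log η / Real.log N * Real.log D + Real.log C - Real.log η) ?_
  filter_upwards [eventually_exists_pow_near hN hD h] with ε ⟨hε, m, hcount, hle, hgt⟩
  have hm : Real.log D + Real.log (1 / ε) ≤ (m + 1) * Real.log N := by
    rw [← log_div_eq_log_add_log_one_div hD hε]
    exact_mod_cast (Real.log_le_log (by positivity) hgt.le).trans_eq (Real.log_pow _ _)
  have hlog : Real.log C + m * Real.log η ≤ Real.log (boxCount E ε) := by
    rw [← Real.log_pow, ← Real.log_mul (by positivity) (by positivity)]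
    exact Real.log_le_log (by positivity) (hcount ε hε hle hgt)
  have hslope : Real.log η / Real.log N * (Real.log D + Real.log (1 / ε)) ≤
      (m + 1) * Real.log η :=
    calc _ ≤ Real.log η / Real.log N * ((m + 1) * Real.log N) := by gcongr
      _ = _ := by field_simp
  linarith

lemma log_mul_div_log (hN : 1 < N) (hθ : 0 < θ) :
    Real.log (N * θ) / Real.log N = 1 + Real.log θ / Real.log N := by
  have hN1 : (1 : ℝ) < N := by exact_mod_cast hN
  rw [Real.log_mul (by positivity) hθ.ne', add_div, div_self (Real.log_pos hN1).ne']

lemma tendsto_one_add_log_div (hθ : 0 < θ) (b : ℝ) {s : Set ℝ} :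
    Tendsto (fun t : ℝ => ((1 + Real.log t / b : ℝ) : EReal)) (𝓝[s] θ)
      (𝓝 ((1 + Real.log θ / b : ℝ) : EReal)) :=
  (continuous_coe_real_ereal.tendsto _).comp <| (((Real.continuousAt_log hθ.ne').tendsto.mono_left
    nhdsWithin_le_nhds).div_const b).const_add 1

lemma upperBoxDim_scaledGraph_le (hF : ContinuousOn F (Icc 0 1)) (hN : 1 < N) (hD : 0 < D)
    (hθ : 1 ≤ θ) (h : ∀ᶠ m in atTop, oscSum F (N ^ m) ≤ C * θ ^ m) :
    upperBoxDim (scaledGraph x₀ D F (Icc 0 1)) ≤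
      ((1 + Real.log θ / Real.log N : ℝ) : EReal) := by
  have hN1 : (1 : ℝ) < N := by exact_mod_cast hN
  rw [← log_mul_div_log hN (by positivity)]
  refine upperBoxDim_le_of_boxCount_le (C := 6 * (C / D + 1) * (N * θ)) hN hD
    (one_le_mul_of_one_le_of_one_le hN1.le hθ) ?_
  filter_upwards [(tendsto_add_atTop_nat 1).eventually h] with m hosc ε hε _ hgt
  have hinv : 1 / ε ≤ (N : ℝ) ^ (m + 1) / D := by
    rw [le_div_iff₀ hD, one_div_mul_eq_div]
    exact hgt.le
  have hwidth : D / (N ^ (m + 1) : ℕ) ≤ ε := by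
    push_cast
    exact (div_le_comm₀ hε (by positivity)).1 hgt.le
  have hθm : (1 : ℝ) ≤ θ ^ (m + 1) := one_le_pow₀ hθ
  have hC : 0 ≤ C * θ ^ (m + 1) := (oscSum_nonneg F _).trans hosc
  calc (boxCount (scaledGraph x₀ D F (Icc 0 1)) ε : ℝ)
      ≤ 6 * (oscSum F (N ^ (m + 1)) * (1 / ε) + (N : ℝ) ^ (m + 1)) := by
        rw [mul_one_div]
        exact_mod_cast boxCount_scaledGraph_le hF hD.le (by positivity) hε hwidth
    _ ≤ 6 * (C * θ ^ (m + 1) * ((N : ℝ) ^ (m + 1) / D) + (N : ℝ) ^ (m + 1) * θ ^ (m + 1)) := by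
        gcongr
        exact le_mul_of_one_le_right (by positivity) hθm
    _ = 6 * (C / D + 1) * (N * θ) * (N * θ) ^ m := by ring

lemma one_le_lowerBoxDim_scaledGraph (hF : ContinuousOn F (Icc 0 1)) (hD : 0 < D) :
    (1 : EReal) ≤ lowerBoxDim (scaledGraph x₀ D F (Icc 0 1)) := by
  have hdim := le_lowerBoxDim_of_le_boxCount (E := scaledGraph x₀ D F (Icc 0 1)) (N := 2)
    (η := 2) (C := 1 / 3) one_lt_two hD one_le_two (by norm_num)
    (Eventually.of_forall fun m ε hε hle _ => by
      have hwidth : ε ≤ D / (2 ^ m : ℕ) := by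
        push_cast
        exact (le_div_comm₀ (by positivity) hε).1 hle
      have hcount := natCast_le_boxCount (x₀ := x₀) hF hD (by positivity) hε hwidth
      push_cast at hcount
      linarith)
  rw [Nat.cast_ofNat, div_self (Real.log_pos one_lt_two).ne'] at hdim
  exact_mod_cast hdim

lemma le_lowerBoxDim_scaledGraph (hF : ContinuousOn F (Icc 0 1)) (hN : 1 < N) (hD : 0 < D)
    (hθ : 1 ≤ θ) (hC : 0 < C) (h : ∀ᶠ m in atTop, C * θ ^ m ≤ oscSum F (N ^ m)) :
    ((1 + Real.log θ / Real.log N : ℝ) : EReal) ≤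
      lowerBoxDim (scaledGraph x₀ D F (Icc 0 1)) := by
  have hN1 : (1 : ℝ) < N := by exact_mod_cast hN
  rw [← log_mul_div_log hN (by positivity)]
  refine le_lowerBoxDim_of_le_boxCount (C := C / (3 * D)) hN hD
    (one_le_mul_of_one_le_of_one_le hN1.le hθ) (by positivity) ?_
  filter_upwards [h] with m hosc ε hε hle _
  have hinv : (N : ℝ) ^ m / D ≤ 1 / ε := by
    rw [div_le_iff₀ hD, one_div_mul_eq_div]
    exact hle
  have hwidth : ε ≤ D / (N ^ m : ℕ) := by
    push_cast
    exact (le_div_comm₀ (by positivity) hε).1 hle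
  calc C / (3 * D) * (N * θ) ^ m = C * θ ^ m * ((N : ℝ) ^ m / D) / 3 := by
        rw [mul_pow]
        field_simp
    _ ≤ oscSum F (N ^ m) * (1 / ε) / 3 := by
        gcongr
        exact oscSum_nonneg F _
    _ ≤ boxCount (scaledGraph x₀ D F (Icc 0 1)) ε := by
        rw [mul_one_div, div_le_iff₀' three_pos]
        exact oscSum_div_le_boxCount hF hD (by positivity) hε hwidth

end Dimension

/-! ### Fractal interpolation functions -/

namespace AffineIFS

open Set

section Param

variable {N : ℕ} (W : AffineIFS N)

/-- The length of `I`. -/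
def len : ℝ := W.x (Fin.last N) - W.x 0

/-- The increasing affine parametrization of `I` by `[0, 1]`; it transports interpolation functions
to self-affine functions on the unit interval. -/
def param (t : ℝ) : ℝ := W.x 0 + W.len * t

include W in
lemma N_pos : 0 < N := two_pos.trans_le W.two_le

include W in
lemma neZero : NeZero N := ⟨W.N_pos.ne'⟩

lemma x_zero_lt_x_last : W.x 0 < W.x (Fin.last N) :=
  W.strictMono_x (Fin.pos_iff_ne_zero.2 fun h => W.N_pos.ne' (congrArg Fin.val h))

lemma len_pos : 0 < W.len := sub_pos.2 W.x_zero_lt_x_last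

lemma strictMono_param : StrictMono W.param :=
  fun _ _ hab => add_lt_add_right (mul_lt_mul_of_pos_left hab W.len_pos) _

lemma continuous_param : Continuous W.param := by
  unfold param
  fun_prop

lemma image_param_Icc (a b : ℝ) : W.param '' Icc a b = Icc (W.param a) (W.param b) := by
  have hcomp : W.param = (fun x => W.x 0 + x) ∘ fun t => W.len * t := rfl
  rw [hcomp, image_comp, image_mul_left_Icc' W.len_pos, image_const_add_Icc]
  rfl

lemma image_param_unit : W.param '' Icc 0 1 = W.I := by
  rw [image_param_Icc, I, param, param, mul_zero, mul_one, add_zero, len, add_sub_cancel]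

lemma param_mem {t : ℝ} (ht : t ∈ Icc (0 : ℝ) 1) : W.param t ∈ W.I :=
  W.image_param_unit ▸ mem_image_of_mem _ ht

lemma continuousOn_comp_param {g : ℝ → ℝ} (hg : ContinuousOn g W.I) :
    ContinuousOn (g ∘ W.param) (Icc 0 1) :=
  hg.comp W.continuous_param.continuousOn fun _ ht => W.param_mem ht

lemma eVariationOn_comp_param (g : ℝ → ℝ) :
    eVariationOn (g ∘ W.param) (Icc 0 1) = eVariationOn g W.I := by
  rw [eVariationOn.comp_eq_of_monotoneOn g _ (W.strictMono_param.monotone.monotoneOn _),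
    image_param_unit]

lemma boundedVariationOn_comp_param {g : ℝ → ℝ} (hg : BoundedVariationOn g W.I) :
    BoundedVariationOn (g ∘ W.param) (Icc 0 1) :=
  (W.eVariationOn_comp_param g).trans_ne hg

lemma graph_eq_scaledGraph (f : ℝ → ℝ) :
    W.graph f = scaledGraph (W.x 0) W.len (f ∘ W.param) (Icc 0 1) := by
  rw [graph, ← image_param_unit, image_image]
  rfl

lemma x_eq_param (hA1 : W.A1) (m : ℕ) (hm : m < N + 1) : W.x ⟨m, hm⟩ = W.param (m / N) := by
  induction m with
  | zero => simp [param]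
  | succ m ih =>
    have hstep := hA1 ⟨m, by omega⟩
    rw [Fin.succ_mk, Fin.castSucc_mk, ih (by omega), sub_eq_iff_eq_add] at hstep
    rw [hstep, param, param, len]
    push_cast
    ring

lemma L_param (hA1 : W.A1) (i : Fin N) (t : ℝ) : W.L i (W.param t) = W.param (cellMap i t) := by
  have hx : W.x i.castSucc = W.param (i / N) := W.x_eq_param hA1 i (by omega)
  have hratio : W.len / N / W.len = 1 / N := by
    rw [div_right_comm, div_self W.len_pos.ne']
  change (W.x i.succ - W.x i.castSucc) / W.len * (W.param t - W.x 0) + W.x i.castSucc = _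
  rw [hA1 i, hx, ← len, hratio, param, param, param, cellMap]
  ring

lemma apply_L {f : ℝ → ℝ} (hf : W.IsFIF f) (i : Fin N) {u : ℝ} (hu : u ∈ W.I) :
    f (W.L i u) = W.S i u * f u + W.q i u := by
  have hmem : W.map i (u, f u) ∈ W.graph f := by
    rw [hf.2]
    exact mem_iUnion.2 ⟨i, mem_image_of_mem _ (mem_image_of_mem _ hu)⟩
  obtain ⟨v, -, hv⟩ := hmem
  obtain ⟨rfl, hfv⟩ := Prod.mk.inj hv
  exact hfv

/-- The functional equation of a fractal interpolation function, rescaled to `[0, 1]`. -/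
noncomputable def selfAffine (hA1 : W.A1) (hS : ∀ i, BoundedVariationOn (W.S i) W.I) (hA3 : W.A3)
    {f : ℝ → ℝ} (hf : W.IsFIF f) : SelfAffine (f ∘ W.param) N where
  S i := W.S i ∘ W.param
  q i := W.q i ∘ W.param
  pos := W.N_pos
  continuousOn_F := W.continuousOn_comp_param hf.1
  continuousOn_S i := W.continuousOn_comp_param (W.continuousOn_S i)
  bv_S i := W.boundedVariationOn_comp_param (hS i)
  bv_q i := W.boundedVariationOn_comp_param (hA3 i)
  map_eq i _ ht :=
    (congrArg f (W.L_param hA1 i _)).symm.trans (W.apply_L hf i (W.param_mem ht))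

lemma A2.boundedVariationOn_S {W : AffineIFS N} (hA2 : W.A2) (i : Fin N) :
    BoundedVariationOn (W.S i) W.I := by
  obtain ⟨K, hK⟩ := (hA2 i).1
  have hends := hK.locallyBoundedVariationOn _ _ (left_mem_Icc.2 W.x_zero_lt_x_last.le)
    (right_mem_Icc.2 W.x_zero_lt_x_last.le)
  rwa [← I, inter_self] at hends

lemma exists_lt_one_forall_abs_S_le : ∃ s < 1, ∀ i, ∀ t ∈ W.I, |W.S i t| ≤ s := by
  have hmax (i : Fin N) : ∃ u ∈ W.I, ∀ t ∈ W.I, |W.S i t| ≤ |W.S i u| :=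
    isCompact_Icc.exists_isMaxOn (nonempty_Icc.2 W.x_zero_lt_x_last.le) (W.continuousOn_S i).abs
  choose u hu hle using hmax
  have := W.neZero
  obtain ⟨i₀, hi₀⟩ := Finite.exists_max fun i => |W.S i (u i)|
  exact ⟨_, W.abs_S_lt_one i₀ _ (hu i₀), fun i t ht => (hle i t ht).trans (hi₀ i)⟩

end Param

section Radius

variable {N : ℕ} (W : AffineIFS N)

lemma subI_eq_image_cell (k : ℕ) (j : Fin (N ^ k)) : W.subI k j = W.param '' cell j := by
  rw [cell, image_param_Icc, subI]
  simp only [param, len, Nat.cast_pow, mul_comm]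

lemma subI_subset (k : ℕ) (j : Fin (N ^ k)) : W.subI k j ⊆ W.I := by
  rw [subI_eq_image_cell, ← image_param_unit]
  exact image_mono (cell_subset_Icc j)

lemma subI_nonempty (k : ℕ) (j : Fin (N ^ k)) : (W.subI k j).Nonempty := by
  rw [subI_eq_image_cell]
  exact ⟨_, mem_image_of_mem _ (left_mem_cell j)⟩

lemma subI_appendDigit_subset (k : ℕ) (j : Fin (N ^ k)) (d : Fin N) :
    W.subI (k + 1) (appendDigit (j, d)) ⊆ W.subI k j := by
  rw [subI_eq_image_cell, subI_eq_image_cell]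
  rw [← image_cellMap_cell (pow_succ N k) (appendDigit_val j d), ← image_cellMap j]
  exact image_mono (image_mono (cell_subset_Icc d))

lemma abs_S_le_sUp {k : ℕ} {i : Fin N} {j : Fin (N ^ k)} {t : ℝ} (ht : t ∈ W.subI k j) :
    |W.S i t| ≤ W.sUp k i j :=
  le_csSup ⟨1, forall_mem_image.2 fun u hu => (W.abs_S_lt_one i u (W.subI_subset k j hu)).le⟩
    (mem_image_of_mem _ ht)

lemma sLow_le_abs_S {k : ℕ} {i : Fin N} {j : Fin (N ^ k)} {t : ℝ} (ht : t ∈ W.subI k j) :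
    W.sLow k i j ≤ |W.S i t| :=
  csInf_le ⟨0, forall_mem_image.2 fun _ _ => abs_nonneg _⟩ (mem_image_of_mem _ ht)

lemma sUp_nonneg (k : ℕ) (i : Fin N) (j : Fin (N ^ k)) : 0 ≤ W.sUp k i j :=
  Real.sSup_nonneg (forall_mem_image.2 fun _ _ => abs_nonneg _)

lemma sLow_nonneg (k : ℕ) (i : Fin N) (j : Fin (N ^ k)) : 0 ≤ W.sLow k i j :=
  Real.sInf_nonneg (forall_mem_image.2 fun _ _ => abs_nonneg _)

lemma sLow_le_sUp (k : ℕ) (i : Fin N) (j : Fin (N ^ k)) : W.sLow k i j ≤ W.sUp k i j :=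
  let ⟨_, ht⟩ := W.subI_nonempty k j
  (W.sLow_le_abs_S ht).trans (W.abs_S_le_sUp ht)

lemma sUp_appendDigit_le (k : ℕ) (i : Fin N) (j : Fin (N ^ k)) (d : Fin N) :
    W.sUp (k + 1) i (appendDigit (j, d)) ≤ W.sUp k i j :=
  csSup_le ((W.subI_nonempty _ _).image _)
    (forall_mem_image.2 fun _ hu => W.abs_S_le_sUp (W.subI_appendDigit_subset k j d hu))

lemma sLow_le_appendDigit (k : ℕ) (i : Fin N) (j : Fin (N ^ k)) (d : Fin N) :
    W.sLow k i j ≤ W.sLow (k + 1) i (appendDigit (j, d)) :=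
  le_csInf ((W.subI_nonempty _ _).image _)
    (forall_mem_image.2 fun _ hu => W.sLow_le_abs_S (W.subI_appendDigit_subset k j d hu))

lemma antitone_radius_MUp : Antitone fun k => matrixSpectralRadius (W.MUp k) :=
  have := W.neZero
  antitone_nat_of_succ_le fun k =>
    matrixSpectralRadius_scalingMatrix_succ_le (W.sUp_nonneg _) (W.sUp_appendDigit_le (k + 1))

lemma monotone_radius_MLow : Monotone fun k => matrixSpectralRadius (W.MLow k) :=
  have := W.neZero
  monotone_nat_of_le_succ fun k =>
    matrixSpectralRadius_scalingMatrix_le_succ (W.sLow_nonneg _) (W.sLow_le_appendDigit (k + 1))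

lemma radius_MLow_le_radius_MUp (k : ℕ) :
    matrixSpectralRadius (W.MLow k) ≤ matrixSpectralRadius (W.MUp k) :=
  have := W.neZero
  matrixSpectralRadius_mono (scalingMatrix_nonneg (W.sLow_nonneg _))
    (scalingMatrix_mono (W.sLow_le_sUp _))

lemma exists_tendsto_radius_MUp :
    ∃ ρ, Tendsto (fun k => matrixSpectralRadius (W.MUp k)) atTop (𝓝 ρ) :=
  ⟨_, tendsto_atTop_ciInf W.antitone_radius_MUp
    ⟨0, forall_mem_range.2 fun _ => matrixSpectralRadius_nonneg _⟩⟩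

lemma exists_tendsto_radius_MLow :
    ∃ ρ, Tendsto (fun k => matrixSpectralRadius (W.MLow k)) atTop (𝓝 ρ) :=
  ⟨_, tendsto_atTop_ciSup W.monotone_radius_MLow ⟨matrixSpectralRadius (W.MUp 0),
    forall_mem_range.2 fun k =>
      (W.radius_MLow_le_radius_MUp k).trans (W.antitone_radius_MUp k.zero_le)⟩⟩

end Radius

section Dimension

variable {N : ℕ} {W : AffineIFS N} {f : ℝ → ℝ} {ρ θ : ℝ}

lemma upperBoxDim_graph_le_of_radius_lt (hA1 : W.A1) (hS : ∀ i, BoundedVariationOn (W.S i) W.I)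
    (hA3 : W.A3) (hf : W.IsFIF f) (hθ1 : 1 ≤ θ) {k : ℕ}
    (hθ : matrixSpectralRadius (W.MUp k) < θ) :
    upperBoxDim (W.graph f) ≤ ((1 + Real.log θ / Real.log N : ℝ) : EReal) := by
  obtain ⟨C, hosc⟩ := (W.selfAffine hA1 hS hA3 hf).exists_oscSum_pow_le (W.sUp_nonneg (k + 1))
    (fun i j t ht => W.abs_S_le_sUp (W.subI_eq_image_cell _ j ▸ mem_image_of_mem _ ht)) hθ1 hθ
  rw [graph_eq_scaledGraph]
  exact upperBoxDim_scaledGraph_le (W.continuousOn_comp_param hf.1) W.two_le W.len_pos hθ1 hosc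

lemma eVariationOn_cell_eq_top (hA1 : W.A1) (hS : ∀ i, BoundedVariationOn (W.S i) W.I)
    (hA3 : W.A3) (hf : W.IsFIF f) (hz : ∀ i, {t ∈ W.I | W.S i t = 0}.Finite)
    (hvar : eVariationOn f W.I = ⊤) {k : ℕ} (r : Fin (N ^ k)) :
    eVariationOn (f ∘ W.param) (cell r) = ⊤ := by
  obtain ⟨s, hs1, hs⟩ := W.exists_lt_one_forall_abs_S_le
  refine (W.selfAffine hA1 hS hA3 hf).eVariationOn_cell_eq_top W.two_le hs1
    (fun i t ht => hs i _ (W.param_mem ht)) (fun i => ?_)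
    ((W.eVariationOn_comp_param f).trans hvar) r
  exact ((hz i).preimage W.strictMono_param.injective.injOn).subset
    fun t ⟨ht, h0⟩ => ⟨W.param_mem ht, h0⟩

lemma le_lowerBoxDim_graph_of_lt_radius (hA1 : W.A1) (hS : ∀ i, BoundedVariationOn (W.S i) W.I)
    (hA3 : W.A3) (hf : W.IsFIF f) (hz : ∀ i, {t ∈ W.I | W.S i t = 0}.Finite)
    (hvar : eVariationOn f W.I = ⊤) (hθ1 : 1 ≤ θ) {k : ℕ}
    (hθ : θ < matrixSpectralRadius (W.MLow k)) :
    ((1 + Real.log θ / Real.log N : ℝ) : EReal) ≤ lowerBoxDim (W.graph f) := by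
  obtain ⟨C, hC, hosc⟩ := (W.selfAffine hA1 hS hA3 hf).exists_le_oscSum_pow W.two_le
    (W.sLow_nonneg (k + 1))
    (fun i j t ht => W.sLow_le_abs_S (W.subI_eq_image_cell _ j ▸ mem_image_of_mem _ ht))
    (eVariationOn_cell_eq_top hA1 hS hA3 hf hz hvar) hθ1 hθ
  rw [graph_eq_scaledGraph]
  exact le_lowerBoxDim_scaledGraph (W.continuousOn_comp_param hf.1) W.two_le W.len_pos hθ1 hC hosc

lemma upperBoxDim_graph_le (hA1 : W.A1) (hS : ∀ i, BoundedVariationOn (W.S i) W.I)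
    (hA3 : W.A3) (hf : W.IsFIF f)
    (hρ : Tendsto (fun k => matrixSpectralRadius (W.MUp k)) atTop (𝓝 ρ)) :
    upperBoxDim (W.graph f) ≤ ((1 + Real.log (max 1 ρ) / Real.log N : ℝ) : EReal) := by
  refine ge_of_tendsto
    (tendsto_one_add_log_div (s := Ioi (max 1 ρ)) (by positivity) (Real.log N)) ?_
  filter_upwards [self_mem_nhdsWithin] with θ hθ
  obtain ⟨hθ1, hθρ⟩ := max_lt_iff.1 (mem_Ioi.1 hθ)
  obtain ⟨k, hk⟩ := (hρ.eventually (gt_mem_nhds hθρ)).exists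
  exact upperBoxDim_graph_le_of_radius_lt hA1 hS hA3 hf hθ1.le hk

lemma one_le_lowerBoxDim_graph (hf : W.IsFIF f) : 1 ≤ lowerBoxDim (W.graph f) := by
  rw [graph_eq_scaledGraph]
  exact one_le_lowerBoxDim_scaledGraph (W.continuousOn_comp_param hf.1) W.len_pos

lemma upperBoxDim_graph_le_one_of_boundedVariationOn (hf : W.IsFIF f)
    (hvar : BoundedVariationOn f W.I) : upperBoxDim (W.graph f) ≤ 1 := by
  have hdim := upperBoxDim_scaledGraph_le (x₀ := W.x 0) (θ := 1)
    (W.continuousOn_comp_param hf.1) W.two_le W.len_pos le_rfl <| Eventually.of_forall fun m => by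
      rw [one_pow, mul_one]
      exact oscSum_le_eVariationOn (W.boundedVariationOn_comp_param hvar) _
  rw [graph_eq_scaledGraph]
  simpa using hdim

lemma le_lowerBoxDim_graph (hA1 : W.A1) (hS : ∀ i, BoundedVariationOn (W.S i) W.I)
    (hA3 : W.A3) (hf : W.IsFIF f) (hz : ∀ i, {t ∈ W.I | W.S i t = 0}.Finite)
    (hvar : eVariationOn f W.I = ⊤)
    (hρ : Tendsto (fun k => matrixSpectralRadius (W.MLow k)) atTop (𝓝 ρ)) :
    ((1 + Real.log ρ / Real.log N : ℝ) : EReal) ≤ lowerBoxDim (W.graph f) := by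
  rcases le_or_gt ρ 1 with hρ1 | hρ1
  · have hρ0 : 0 ≤ ρ := ge_of_tendsto' hρ fun _ => matrixSpectralRadius_nonneg _
    refine le_trans ?_ (one_le_lowerBoxDim_graph hf)
    exact_mod_cast add_le_of_nonpos_right
      (div_nonpos_of_nonpos_of_nonneg (Real.log_nonpos hρ0 hρ1) (Real.log_natCast_nonneg N))
  · refine le_of_tendsto (tendsto_one_add_log_div (s := Iio ρ) (by positivity) (Real.log N)) ?_
    filter_upwards [Ioo_mem_nhdsLT hρ1] with θ hθ
    obtain ⟨k, hk⟩ := (hρ.eventually (lt_mem_nhds hθ.2)).exists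
    exact le_lowerBoxDim_graph_of_lt_radius hA1 hS hA3 hf hz hvar hθ.1.le hk

end Dimension

end AffineIFS

theorem mainTheorem1_general (N : ℕ) (W : AffineIFS N) (hA1 : W.A1)
    (hS : ∀ i, BoundedVariationOn (W.S i) W.I) (hA3 : W.A3) (f : ℝ → ℝ) (hf : W.IsFIF f) :
    ∃ rhoUp rhoLow : ℝ,
      Tendsto (fun k => matrixSpectralRadius (W.MUp k)) atTop (𝓝 rhoUp) ∧
      Tendsto (fun k => matrixSpectralRadius (W.MLow k)) atTop (𝓝 rhoLow) ∧
      upperBoxDim (W.graph f) ≤ ((max 1 (1 + Real.log rhoUp / Real.log N) : ℝ) : EReal) ∧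
      ((∀ i, {t ∈ W.I | W.S i t = 0}.Finite) → eVariationOn f W.I = ⊤ →
        ((1 + Real.log rhoLow / Real.log N : ℝ) : EReal) ≤ lowerBoxDim (W.graph f)) ∧
      (rhoLow = rhoUp → (∀ i, {t ∈ W.I | W.S i t = 0}.Finite) →
        eVariationOn f W.I = ⊤ ∧ 1 < rhoUp →
          HasBoxDim (W.graph f) (1 + Real.log rhoUp / Real.log N)) ∧
      (¬ (eVariationOn f W.I = ⊤ ∧ 1 < rhoUp) → HasBoxDim (W.graph f) 1) := by
  obtain ⟨rhoUp, hUp⟩ := W.exists_tendsto_radius_MUp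
  obtain ⟨rhoLow, hLow⟩ := W.exists_tendsto_radius_MLow
  have hupper := AffineIFS.upperBoxDim_graph_le hA1 hS hA3 hf hUp
  have hlower (hz : ∀ i, {t ∈ W.I | W.S i t = 0}.Finite) (hvar : eVariationOn f W.I = ⊤) :=
    AffineIFS.le_lowerBoxDim_graph hA1 hS hA3 hf hz hvar hLow
  refine ⟨rhoUp, rhoLow, hUp, hLow, ?_, hlower, ?_, fun hnot => ?_⟩
  · refine hupper.trans (EReal.coe_le_coe_iff.2 ?_)
    rcases le_total rhoUp 1 with h | h <;> simp [h]
  · rintro rfl hz ⟨hvar, hρ⟩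
    rw [max_eq_right hρ.le] at hupper
    exact hasBoxDim_of_le (hlower hz hvar) hupper
  · refine hasBoxDim_of_le (AffineIFS.one_le_lowerBoxDim_graph hf) ?_
    by_cases hvar : eVariationOn f W.I = ⊤
    · have hρ : rhoUp ≤ 1 := not_lt.1 fun h => hnot ⟨hvar, h⟩
      simpa [max_eq_left hρ] using hupper
    · exact AffineIFS.upperBoxDim_graph_le_one_of_boundedVariationOn hf hvar

theorem mainTheorem1 (N : ℕ) (W : AffineIFS N) (hA1 : W.A1) (hA2 : W.A2) (hA3 : W.A3)
    (f : ℝ → ℝ) (hf : W.IsFIF f) :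
    ∃ rhoUp rhoLow : ℝ,
      Tendsto (fun k => matrixSpectralRadius (W.MUp k)) atTop (𝓝 rhoUp) ∧
      Tendsto (fun k => matrixSpectralRadius (W.MLow k)) atTop (𝓝 rhoLow) ∧
      ((∀ i, ∀ a b : ℝ, a < b → Set.Icc a b ⊆ W.I → ∃ t ∈ Set.Icc a b, W.S i t ≠ 0) →
        upperBoxDim (W.graph f) ≤
          ((max 1 (1 + Real.log rhoUp / Real.log N) : ℝ) : EReal)) ∧
      (1 ≤ W.gammaLow → (∀ i, {t ∈ W.I | W.S i t = 0}.Finite) → eVariationOn f W.I = ⊤ →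
        ((1 + Real.log rhoLow / Real.log N : ℝ) : EReal) ≤ lowerBoxDim (W.graph f)) ∧
      (rhoLow = rhoUp → (∀ i, {t ∈ W.I | W.S i t = 0}.Finite) →
        (eVariationOn f W.I = ⊤ ∧ 1 < rhoUp →
          HasBoxDim (W.graph f) (1 + Real.log rhoUp / Real.log N)) ∧
        (¬ (eVariationOn f W.I = ⊤ ∧ 1 < rhoUp) → HasBoxDim (W.graph f) 1)) := by
  obtain ⟨rhoUp, rhoLow, hUp, hLow, hupper, hlower, hdim, hdim_one⟩ :=
    mainTheorem1_general N W hA1 hA2.boundedVariationOn_S hA3 f hf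
  exact ⟨rhoUp, rhoLow, hUp, hLow, fun _ => hupper, fun _ => hlower,
    fun heq hz => ⟨hdim heq hz, hdim_one⟩⟩
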